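/- **Setting.** A *category with families* (CwF) is a category $\mathcal C$ of contexts with a chosen terminal object $\diamond$, a presheaf $\mathsf{Ty}$ of types and a dependent presheaf $\mathsf{Tm}$ of terms over $\mathsf{Ty}$, such that for every context $\Gamma$ and type $A$ over $\Gamma$ there is a chosen extended context $\Gamma.A$ with a projection $p_A:\Gamma.A\to\Gamma$ and a generic term $q_A$ of type $A[p_A]$ over $\Gamma.A$ that represents the terms of type $A$. Let $\mathbf{CwF}$ be the category of (small) CwFs and strict morphisms (functors with actions on types and terms that preserve all the structure on the nose). Let $I=\{I^{\mathsf{ty}},I^{\mathsf{tm}}\}$, where $I^{\mathsf{ty}}$ is the canonical map from the CwF freely generated by an object $\mathbf\Gamma$ to the CwF freely generated by an object $\mathbf\Gamma$ and a type $\mathbf A$ over $\mathbf\Gamma$, and $I^{\mathsf{tm}}$ is the canonical map from the latter to the CwF freely generated by an object $\mathbf\Gamma$, a type $\mathbf A$ over $\mathbf\Gamma$ and a term $\mathbf a$ of type $\mathbf A$. A CwF $\mathcal C$ is *$I$-cellular* if the map $\mathbf 0\to\mathcal C$ from the initial CwF is the composite of a sequence, indexed by the natural numbers, of maps each of which is a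 pushout of a coproduct of maps in $I$. A *telescope* $\Delta=A_1.A_2.\cdots.A_n$ over $\Gamma$ is a finite sequence in which $A_{i+1}$ is a type over $\Gamma.A_1.\cdots.A_i$; it gives an extended context $\Gamma.\Delta$, and every $\rho:\Theta\to\Gamma$ induces a telescope $\Delta[\rho]$ over $\Theta$ and a morphism $\rho^+:\Theta.\Delta[\rho]\to\Gamma.\Delta$. In an $I$-cellular CwF every context is the extension $\diamond.T$ of the empty context by a unique telescope $T$; the *length* of the context is the length of $T$. A *unification context* is a context of the form $\Gamma.\Delta$ with $\Delta$ a telescope over $\Gamma$; the variables of $\Gamma$ are called flexible, those of $\Delta$ rigid. Let $X$ be a dependent presheaf over $\Gamma.\Delta$ and $x_1,x_2$ two elements of $X$ over $\Gamma.\Delta$. A *unifier* of $x_1,x_2$ is a morphism $\rho:\Theta\to\Gamma$ such that $x_1[\rho^+]=x_2[\rho^+]$. A *most general unifier* is a terminal one: a unifier $\rho:\Omega\to\Gamma$ such that for every unifier $\sigma:\Theta\to\Gamma$ there is a unique $\tau:\Theta\to\Omega$ with $\rho\circ\tau=\sigma$. **Theorem (First-order unification).** Let $\mathcal C$ be an $I$-cellular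 CwF, let $\Gamma.\Delta$ be a unification context of $\mathcal C$, and let $X$ be a dependent presheaf over $\Gamma.\Delta$ of one of the forms - $\mathsf{Tm}^\star(\Xi)$, for a telescope $\Xi$ over $\Gamma.\Delta$ (its elements are the telescopes of terms of type $\Xi$, that is, the substitutions into $\Gamma.\Delta.\Xi$ over $\Gamma.\Delta$), - $\mathsf{Ty}$, or - $\mathsf{Tm}(A)$, for a type $A$ over $\Gamma.\Delta$. If two elements $x_1,x_2$ of $X$ over $\Gamma.\Delta$ have a unifier, then they have a most general unifier $\rho:\Omega\to\Gamma$ such that either $\rho$ is the identity of $\Gamma$ or the length of $\Omega$ is strictly less than the length of $\Gamma$. -/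

import Mathlib

open CategoryTheory CategoryTheory.Limits Opposite

/-! Morphisms of a category are read through `CategoryStruct.toQuiver`, as everywhere in the library. -/
attribute [-instance] CategoryTheory.catToReflQuiver

universe u

/-- A category with families. The category of contexts has a terminal object `empty`. Types and
terms are presheaves `Ty` and `Tm`, and `tp` sends a term to its type: the set of terms of type
`A : Ty Γ` is the fibre `{a : Tm Γ // tp a = A}`. For every type `A` over `Γ` the restricted
presheaf of terms of type `A` is represented by `p A : ext A ⟶ Γ` with generic term `q A`. -/
structure CwF : Type (u + 1) where
  Ctx : Type u
  [cat : SmallCategory Ctx]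
  empty : Ctx
  emptyIsTerminal : IsTerminal empty
  Ty : Ctx → Type u
  tySub : ∀ {Γ Δ : Ctx}, (Δ ⟶ Γ) → Ty Γ → Ty Δ
  tySub_id : ∀ {Γ : Ctx} (A : Ty Γ), tySub (𝟙 Γ) A = A
  tySub_comp : ∀ {Γ Δ Θ : Ctx} (τ : Θ ⟶ Δ) (σ : Δ ⟶ Γ) (A : Ty Γ),
    tySub (τ ≫ σ) A = tySub τ (tySub σ A)
  Tm : Ctx → Type u
  tmSub : ∀ {Γ Δ : Ctx}, (Δ ⟶ Γ) → Tm Γ → Tm Δ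
  tmSub_id : ∀ {Γ : Ctx} (a : Tm Γ), tmSub (𝟙 Γ) a = a
  tmSub_comp : ∀ {Γ Δ Θ : Ctx} (τ : Θ ⟶ Δ) (σ : Δ ⟶ Γ) (a : Tm Γ),
    tmSub (τ ≫ σ) a = tmSub τ (tmSub σ a)
  tp : ∀ {Γ : Ctx}, Tm Γ → Ty Γ
  tp_tmSub : ∀ {Γ Δ : Ctx} (σ : Δ ⟶ Γ) (a : Tm Γ), tp (tmSub σ a) = tySub σ (tp a)
  ext : ∀ {Γ : Ctx}, Ty Γ → Ctx
  p : ∀ {Γ : Ctx} (A : Ty Γ), ext A ⟶ Γ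
  q : ∀ {Γ : Ctx} (A : Ty Γ), Tm (ext A)
  tp_q : ∀ {Γ : Ctx} (A : Ty Γ), tp (q A) = tySub (p A) A
  pair : ∀ {Γ Δ : Ctx} (σ : Δ ⟶ Γ) (A : Ty Γ) (a : Tm Δ), tp a = tySub σ A → (Δ ⟶ ext A)
  pair_p : ∀ {Γ Δ : Ctx} (σ : Δ ⟶ Γ) (A : Ty Γ) (a : Tm Δ) (h : tp a = tySub σ A),
    pair σ A a h ≫ p A = σ
  pair_q : ∀ {Γ Δ : Ctx} (σ : Δ ⟶ Γ) (A : Ty Γ) (a : Tm Δ) (h : tp a = tySub σ A),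
    tmSub (pair σ A a h) (q A) = a
  ext_hom_ext : ∀ {Γ Δ : Ctx} (A : Ty Γ) (θ θ' : Δ ⟶ ext A),
    θ ≫ p A = θ' ≫ p A → tmSub θ (q A) = tmSub θ' (q A) → θ = θ'

namespace CwF

attribute [instance] CwF.cat

/-- A strict morphism of categories with families: a functor with compatible actions on types and
terms that preserves the empty context, the context extensions, the projections and the generic
terms on the nose. -/
@[ext]
structure Hom (C D : CwF.{u}) : Type u where
  functor : C.Ctx ⥤ D.Ctx
  ty : ∀ {Γ : C.Ctx}, C.Ty Γ → D.Ty (functor.obj Γ)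
  ty_sub : ∀ {Γ Δ : C.Ctx} (σ : Δ ⟶ Γ) (A : C.Ty Γ),
    ty (C.tySub σ A) = D.tySub (functor.map σ) (ty A)
  tm : ∀ {Γ : C.Ctx}, C.Tm Γ → D.Tm (functor.obj Γ)
  tm_sub : ∀ {Γ Δ : C.Ctx} (σ : Δ ⟶ Γ) (a : C.Tm Γ),
    tm (C.tmSub σ a) = D.tmSub (functor.map σ) (tm a)
  tp_tm : ∀ {Γ : C.Ctx} (a : C.Tm Γ), D.tp (tm a) = ty (C.tp a)
  obj_empty : functor.obj C.empty = D.empty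
  obj_ext : ∀ {Γ : C.Ctx} (A : C.Ty Γ), functor.obj (C.ext A) = D.ext (ty A)
  map_p : ∀ {Γ : C.Ctx} (A : C.Ty Γ),
    functor.map (C.p A) = eqToHom (obj_ext A) ≫ D.p (ty A)
  tm_q : ∀ {Γ : C.Ctx} (A : C.Ty Γ),
    tm (C.q A) = D.tmSub (eqToHom (obj_ext A)) (D.q (ty A))

/-- The identity morphism. -/
def Hom.id (C : CwF.{u}) : Hom C C where
  functor := 𝟭 C.Ctx
  ty A := A
  ty_sub _ _ := rfl
  tm a := a
  tm_sub _ _ := rfl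
  tp_tm _ := rfl
  obj_empty := rfl
  obj_ext _ := rfl
  map_p A := by simp
  tm_q A := by simp [C.tmSub_id]

/-- Composition of strict morphisms. -/
def Hom.comp {C D E : CwF.{u}} (F : Hom C D) (G : Hom D E) : Hom C E where
  functor := F.functor ⋙ G.functor
  ty A := G.ty (F.ty A)
  ty_sub σ A := by simp [F.ty_sub, G.ty_sub]
  tm a := G.tm (F.tm a)
  tm_sub σ a := by simp [F.tm_sub, G.tm_sub]
  tp_tm a := by rw [G.tp_tm, F.tp_tm]
  obj_empty := by simp [F.obj_empty, G.obj_empty]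
  obj_ext A := by simp [F.obj_ext, G.obj_ext]
  map_p A := by simp [F.map_p, G.map_p, eqToHom_map]
  tm_q A := by simp [F.tm_q, G.tm_sub, G.tm_q, eqToHom_map, ← E.tmSub_comp]

/-- The category of categories with families and strict morphisms. -/
instance : LargeCategory CwF.{u} where
  Hom := Hom
  id := Hom.id
  comp := Hom.comp

/-! ### Cellular objects -/

/-- `F` is the CwF freely generated by an object `Γ`. -/
def IsFreeOb (F : CwF.{u}) (Γ : F.Ctx) : Prop :=
  ∀ (E : CwF.{u}) (Θ : E.Ctx), ∃! f : F ⟶ E, f.functor.obj Γ = Θ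

/-- `F` is the CwF freely generated by an object `Γ` and a type `A` over `Γ`. -/
def IsFreeTy (F : CwF.{u}) (Γ : F.Ctx) (A : F.Ty Γ) : Prop :=
  ∀ (E : CwF.{u}) (Θ : E.Ctx) (B : E.Ty Θ),
    ∃! f : F ⟶ E, ∃ h : f.functor.obj Γ = Θ, f.ty A = E.tySub (eqToHom h) B

/-- `F` is the CwF freely generated by an object `Γ`, a type over `Γ`, and a term `a` of that
type (the type is `F.tp a`, and a term of `E` carries its type `E.tp b` along). -/
def IsFreeTm (F : CwF.{u}) (Γ : F.Ctx) (a : F.Tm Γ) : Prop :=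
  ∀ (E : CwF.{u}) (Θ : E.Ctx) (b : E.Tm Θ),
    ∃! f : F ⟶ E, ∃ h : f.functor.obj Γ = Θ, f.tm a = E.tmSub (eqToHom h) b

/-- The map `Free(Γ : Ob) ⟶ Free(A : Ty Γ)`, up to the choice of the free objects. -/
def genTy : MorphismProperty CwF.{u} := fun X Y i =>
  ∃ Γ : X.Ctx, X.IsFreeOb Γ ∧
    ∃ A : Y.Ty (i.functor.obj Γ), Y.IsFreeTy (i.functor.obj Γ) A

/-- The map `Free(A : Ty Γ) ⟶ Free(a : Tm Γ A)`, up to the choice of the free objects. -/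
def genTm : MorphismProperty CwF.{u} := fun X Y i =>
  ∃ (Γ : X.Ctx) (A : X.Ty Γ), X.IsFreeTy Γ A ∧
    ∃ a : Y.Tm (i.functor.obj Γ), Y.tp a = i.ty A ∧ Y.IsFreeTm (i.functor.obj Γ) a

/-- The generating maps `I = {I^ty, I^tm}`. -/
def genI : MorphismProperty CwF.{u} := genTy ⊔ genTm

/-- Basic `I`-cellular maps: pushouts of (small) coproducts of maps in `I`. -/
def basicCellular : MorphismProperty CwF.{u} :=
  (MorphismProperty.coproducts.{u} genI).pushouts

/-- `I`-cellular maps: composites of `ω`-sequences of basic `I`-cellular maps. -/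
def cellular : MorphismProperty CwF.{u} :=
  basicCellular.transfiniteCompositionsOfShape ℕ

/-- `C` is an `I`-cellular object: the unique map from the initial CwF is `I`-cellular. -/
def IsCellular (C : CwF.{u}) : Prop :=
  ∃ (O : CwF.{u}) (hO : IsInitial O), cellular (hO.to C)

/-! ### Telescopes -/

/-- The morphism `σ⁺ : Δ.A[σ] ⟶ Γ.A` induced by `σ : Δ ⟶ Γ`. -/
def lift (C : CwF.{u}) {Γ Δ : C.Ctx} (σ : Δ ⟶ Γ) (A : C.Ty Γ) :
    C.ext (C.tySub σ A) ⟶ C.ext A :=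
  C.pair (C.p (C.tySub σ A) ≫ σ) A (C.q (C.tySub σ A)) (by rw [C.tp_q, C.tySub_comp])

/-- Telescopes of types over a context: finite sequences `A₁.A₂.⋯.Aₙ`, each type living over the
extension of the context by the previous ones. -/
inductive Tele (C : CwF.{u}) : C.Ctx → Type u
  | nil {Γ : C.Ctx} : Tele C Γ
  | cons {Γ : C.Ctx} (A : C.Ty Γ) (Δ : Tele C (C.ext A)) : Tele C Γ

namespace Tele

variable {C : CwF.{u}}

/-- The number of types of a telescope. -/
def length : {Γ : C.Ctx} → Tele C Γ → ℕ
  | _, nil => 0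
  | _, cons _ Δ => Δ.length + 1

/-- The extended context `Γ.Δ`. -/
def ext : {Γ : C.Ctx} → Tele C Γ → C.Ctx
  | Γ, nil => Γ
  | _, cons _ Δ => Δ.ext

/-- The projection `Γ.Δ ⟶ Γ`. -/
def proj : {Γ : C.Ctx} → (Δ : Tele C Γ) → (Δ.ext ⟶ Γ)
  | Γ, nil => 𝟙 Γ
  | _, cons A Δ => Δ.proj ≫ C.p A

/-- The substituted telescope `Δ[ρ]`. -/
def sub : {Γ Θ : C.Ctx} → (ρ : Θ ⟶ Γ) → Tele C Γ → Tele C Θ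
  | _, _, _, nil => nil
  | _, _, ρ, cons A Δ => cons (C.tySub ρ A) (Δ.sub (C.lift ρ A))

/-- The morphism `ρ⁺ : Θ.Δ[ρ] ⟶ Γ.Δ` induced by `ρ : Θ ⟶ Γ`. -/
def lift : {Γ Θ : C.Ctx} → (ρ : Θ ⟶ Γ) → (Δ : Tele C Γ) → ((Δ.sub ρ).ext ⟶ Δ.ext)
  | _, _, ρ, nil => ρ
  | _, _, ρ, cons A Δ => Δ.lift (C.lift ρ A)

end Tele

/-- `Γ` has length `n`: it is the extension of the empty context by a closed telescope, and every
such telescope has length `n`. -/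
def HasLength (C : CwF.{u}) (Γ : C.Ctx) (n : ℕ) : Prop :=
  (∃ T : Tele C C.empty, T.ext = Γ) ∧ ∀ T : Tele C C.empty, T.ext = Γ → T.length = n

/-! ### Dependent presheaves over a context, and unifiers -/

/-- Dependent presheaves over (the presheaf represented by) a context `Θ`: to `σ : Θ' ⟶ Θ`
they assign the set `X(σ)`. -/
abbrev DepPsh (C : CwF.{u}) (Θ : C.Ctx) := (Over Θ)ᵒᵖ ⥤ Type u

/-- The elements `(x : y(Θ)) → X(x)`, given by their value at the identity. -/
abbrev DepPsh.Elt {C : CwF.{u}} {Θ : C.Ctx} (X : C.DepPsh Θ) : Type u :=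
  X.obj (op (Over.mk (𝟙 Θ)))

/-- The restriction `x[σ]` of an element along `σ : Θ' ⟶ Θ`. -/
def DepPsh.Elt.restrict {C : CwF.{u}} {Θ Θ' : C.Ctx} {X : C.DepPsh Θ} (x : X.Elt)
    (σ : Θ' ⟶ Θ) : X.obj (op (Over.mk σ)) :=
  X.map (Over.homMk σ : Over.mk σ ⟶ Over.mk (𝟙 Θ)).op x

/-- The presheaf of types, over `Θ`. -/
def tyPsh (C : CwF.{u}) (Θ : C.Ctx) : C.DepPsh Θ where
  obj Y := C.Ty Y.unop.left
  map f := ↾ C.tySub f.unop.left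
  map_id Y := by ext A; exact C.tySub_id A
  map_comp f g := by ext A; exact C.tySub_comp _ _ A

/-- The dependent presheaf of terms of type `A`. -/
def tmPsh (C : CwF.{u}) {Θ : C.Ctx} (A : C.Ty Θ) : C.DepPsh Θ where
  obj Y := {a : C.Tm Y.unop.left // C.tp a = C.tySub Y.unop.hom A}
  map f := ↾ fun a => ⟨C.tmSub f.unop.left a.1, by
    rw [C.tp_tmSub, a.2, ← C.tySub_comp, Over.w]⟩
  map_id Y := by ext a; exact C.tmSub_id a.1
  map_comp f g := by ext a; exact C.tmSub_comp _ _ a.1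

/-- The dependent presheaf of telescopes of terms of type `Ξ`. As telescopes of terms are
represented by the extended context, these are the substitutions into `Θ.Ξ` over `Θ`. -/
def teleTmPsh (C : CwF.{u}) {Θ : C.Ctx} (Ξ : Tele C Θ) : C.DepPsh Θ where
  obj Y := {f : Y.unop.left ⟶ Ξ.ext // f ≫ Ξ.proj = Y.unop.hom}
  map g := ↾ fun f => ⟨g.unop.left ≫ f.1, by rw [Category.assoc, f.2, Over.w]⟩
  map_id Y := by ext f; exact Category.id_comp f.1
  map_comp g h := by ext f; exact Category.assoc _ _ f.1

/-- The dependent presheaves of telescopes of terms, of types, and of terms of a given type. -/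
inductive IsSort (C : CwF.{u}) {Θ : C.Ctx} : C.DepPsh Θ → Prop
  | teleTm (Ξ : Tele C Θ) : IsSort C (C.teleTmPsh Ξ)
  | ty : IsSort C (C.tyPsh Θ)
  | tm (A : C.Ty Θ) : IsSort C (C.tmPsh A)

section Unifiers

variable {C : CwF.{u}} {Γ : C.Ctx}

/-- `ρ : Θ ⟶ Γ` is a unifier of two elements over the unification context `Γ.Δ` (with flexible
part `Γ` and rigid part `Δ`): they become equal after restriction along `ρ⁺`. -/
def IsUnifier (Δ : Tele C Γ) {X : C.DepPsh Δ.ext} (x₁ x₂ : X.Elt) {Θ : C.Ctx} (ρ : Θ ⟶ Γ) :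
    Prop :=
  x₁.restrict (Δ.lift ρ) = x₂.restrict (Δ.lift ρ)

/-- A most general unifier: a terminal object among the unifiers, as objects over `Γ`. -/
def IsMostGeneralUnifier (Δ : Tele C Γ) {X : C.DepPsh Δ.ext} (x₁ x₂ : X.Elt) {Ω : C.Ctx}
    (ρ : Ω ⟶ Γ) : Prop :=
  IsUnifier Δ x₁ x₂ ρ ∧
    ∀ (Θ : C.Ctx) (σ : Θ ⟶ Γ), IsUnifier Δ x₁ x₂ σ → ∃! τ : Θ ⟶ Ω, τ ≫ ρ = σ

end Unifiers

end CwF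

/-! An I-cellular CwF is dependently typed syntax over a signature of type and term symbols subject
to no equations, so classical first-order unification applies to it. Much of the work is to recover
the syntax from the universal properties of the cells.

Attaching cells gives a lifting property (`IsCellular.exists_generators`): a morphism out of C lifts
along F as soon as the generators can be lifted, with prescribed properties of their lifts. Three
uses of it yield a `Presentation`. A section of the contextual core exhibits contexts as iterated
extensions (`Generates.exists_con`). A section of a sub-CwF shows that every type is an instance of
a symbol and every term a variable or an instance of a symbol (`Generates.forms`). A lift to raw
expressions interprets C in untyped syntax (`Generates.exists_raw`), and this interpretation is
injective (`rTm_injective`, `rTy_injective`, `rHom_injective`).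

Unification then follows the usual cases. Two instances of symbols that unify have the same symbol,
and their unifiers are those of the argument substitutions. A rigid variable unifies only with
itself. A flexible variable x that unifies with t ≠ x does not occur in t, and t contains no rigid
variable (`hasMGU_var`). The dependently typed difficulty is to eliminate x when t uses variables
declared after x: the context is first rearranged so that only variables depending on x follow it
(`exists_split`). Then t lives before x, and the most general unifier is the pullback of the section
given by t; it has one variable less (`exists_mgu_var`). Termination is by the number of flexible
variables, and for a fixed number by the raw expression of the first term. -/

namespace CwF

/-! ### Lifting along cellular maps -/

/-- The action of a morphism on types together with their contexts. -/
def Hom.sty {C D : CwF.{u}} (f : C ⟶ D) (x : Σ Γ, C.Ty Γ) : Σ Γ, D.Ty Γ :=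
  ⟨f.functor.obj x.1, f.ty x.2⟩

/-- The action of a morphism on terms together with their contexts. -/
def Hom.stm {C D : CwF.{u}} (f : C ⟶ D) (x : Σ Γ, C.Tm Γ) : Σ Γ, D.Tm Γ :=
  ⟨f.functor.obj x.1, f.tm x.2⟩

/-- The type of a term, together with their context. -/
def stp {C : CwF.{u}} (x : Σ Γ, C.Tm Γ) : Σ Γ, C.Ty Γ := ⟨x.1, C.tp x.2⟩

theorem Hom.sty_comp {C D E : CwF.{u}} (f : C ⟶ D) (g : D ⟶ E) (x : Σ Γ, C.Ty Γ) :
    Hom.sty (f ≫ g) x = Hom.sty g (Hom.sty f x) := rfl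

theorem Hom.stm_comp {C D E : CwF.{u}} (f : C ⟶ D) (g : D ⟶ E) (x : Σ Γ, C.Tm Γ) :
    Hom.stm (f ≫ g) x = Hom.stm g (Hom.stm f x) := rfl

theorem Hom.stp_stm {C D : CwF.{u}} (f : C ⟶ D) (x : Σ Γ, C.Tm Γ) :
    stp (Hom.stm f x) = Hom.sty f (stp x) := by
  simp only [stp, stm, sty, Hom.tp_tm]

/-- Equality of pairs absorbs the transports along `eqToHom` in the freeness conditions. -/
theorem sty_eq_iff {D : CwF.{u}} {Γ Θ : D.Ctx} {A : D.Ty Γ} {B : D.Ty Θ} :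
    (⟨Γ, A⟩ : Σ Γ, D.Ty Γ) = ⟨Θ, B⟩ ↔ ∃ h : Γ = Θ, A = D.tySub (eqToHom h) B := by
  constructor
  · intro h
    cases h
    exact ⟨rfl, (D.tySub_id _).symm⟩
  · rintro ⟨rfl, h⟩
    rw [h, eqToHom_refl, D.tySub_id]

theorem stm_eq_iff {D : CwF.{u}} {Γ Θ : D.Ctx} {a : D.Tm Γ} {b : D.Tm Θ} :
    (⟨Γ, a⟩ : Σ Γ, D.Tm Γ) = ⟨Θ, b⟩ ↔ ∃ h : Γ = Θ, a = D.tmSub (eqToHom h) b := by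
  constructor
  · intro h
    cases h
    exact ⟨rfl, (D.tmSub_id _).symm⟩
  · rintro ⟨rfl, h⟩
    rw [h, eqToHom_refl, D.tmSub_id]

/-- Lifting data for the type generators `CT` and the term generators `CM` of `Y`, along
`F : R ⟶ B` and over `g : Y ⟶ B`: every generator has a lift that is related to it by `PT`,
respectively `PM`. -/
structure LiftData {Y R B : CwF.{u}} (CT : Set (Σ Γ, Y.Ty Γ)) (CM : Set (Σ Γ, Y.Tm Γ))
    (F : R ⟶ B) (g : Y ⟶ B) (PT : (Σ Γ, Y.Ty Γ) → (Σ Γ, R.Ty Γ) → Prop)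
    (PM : (Σ Γ, Y.Tm Γ) → (Σ Γ, R.Tm Γ) → Prop) : Prop where
  liftTy : ∀ x ∈ CT, ∀ G : R.Ctx, F.functor.obj G = g.functor.obj x.1 →
    ∃ A : R.Ty G, Hom.sty F ⟨G, A⟩ = Hom.sty g x ∧ PT x ⟨G, A⟩
  liftTm : ∀ x ∈ CM, ∀ y : Σ Γ, R.Ty Γ, Hom.sty F y = Hom.sty g (stp x) →
    ∃ a : R.Tm y.1, R.tp a = y.2 ∧ Hom.stm F ⟨y.1, a⟩ = Hom.stm g x ∧ PM x ⟨y.1, a⟩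

/-- `i : X ⟶ Y` freely adjoins the types `CT` and the terms `CM`, as far as the existence of lifts
is concerned. -/
def HasCells {X Y : CwF.{u}} (i : X ⟶ Y) (CT : Set (Σ Γ, Y.Ty Γ)) (CM : Set (Σ Γ, Y.Tm Γ)) :
    Prop :=
  ∀ ⦃R B : CwF.{u}⦄ (F : R ⟶ B) (g : Y ⟶ B) (l : X ⟶ R)
    (PT : (Σ Γ, Y.Ty Γ) → (Σ Γ, R.Ty Γ) → Prop) (PM : (Σ Γ, Y.Tm Γ) → (Σ Γ, R.Tm Γ) → Prop),
    l ≫ F = i ≫ g → LiftData CT CM F g PT PM →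
    ∃ l' : Y ⟶ R, i ≫ l' = l ∧ l' ≫ F = g ∧ (∀ x ∈ CT, PT x (Hom.sty l' x)) ∧
      ∀ x ∈ CM, PM x (Hom.stm l' x)

/-- A morphism out of the free CwF on a type is a choice of a type, so a lift of the generator names
the lifted morphism. Uniqueness for X and for Y gives the two commuting triangles. -/
theorem hasCells_genTy {X Y : CwF.{u}} (i : X ⟶ Y) (hi : genTy i) :
    ∃ CT CM, HasCells i CT CM := by
  obtain ⟨Γ, hΓ, A, hA⟩ := hi
  refine ⟨{⟨i.functor.obj Γ, A⟩}, ∅, ?_⟩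
  intro R B F g l PT PM sq hL
  have e : F.functor.obj (l.functor.obj Γ) = g.functor.obj (i.functor.obj Γ) :=
    congrArg (fun k : X ⟶ B => k.functor.obj Γ) sq
  obtain ⟨A', hA', hP⟩ := hL.liftTy _ rfl (l.functor.obj Γ) e
  obtain ⟨l', h', -⟩ := hA R _ A'
  have h'' : Hom.sty l' ⟨i.functor.obj Γ, A⟩ = ⟨_, A'⟩ := sty_eq_iff.2 h'
  refine ⟨l', (hΓ R (l.functor.obj Γ)).unique (congrArg Sigma.fst h'') rfl, ?_, ?_, by simp⟩
  · refine (hA B _ (g.ty A)).unique (sty_eq_iff.1 ?_) (sty_eq_iff.1 rfl)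
    change Hom.sty F (Hom.sty l' ⟨i.functor.obj Γ, A⟩) = Hom.sty g ⟨_, A⟩
    rw [h'', hA']
  · rintro x rfl
    rw [h'']
    exact hP

/-- The type of the new term comes from X, where `l` has already lifted it. This is why `liftTm` has
to supply a term over an arbitrary given lift of the type. -/
theorem hasCells_genTm {X Y : CwF.{u}} (i : X ⟶ Y) (hi : genTm i) :
    ∃ CT CM, HasCells i CT CM := by
  obtain ⟨Γ, A, hA, a, ha, hfree⟩ := hi
  refine ⟨∅, {⟨i.functor.obj Γ, a⟩}, ?_⟩
  intro R B F g l PT PM sq hL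
  have e : Hom.sty F (Hom.sty l ⟨Γ, A⟩) = Hom.sty g (stp ⟨i.functor.obj Γ, a⟩) := by
    have := congrArg (fun k : X ⟶ B => Hom.sty k ⟨Γ, A⟩) sq
    simp only [stp, ha]
    exact this
  obtain ⟨a', ha', hF, hP⟩ := hL.liftTm _ rfl _ e
  obtain ⟨l', h', -⟩ := hfree R _ a'
  have h'' : Hom.stm l' ⟨i.functor.obj Γ, a⟩ = ⟨_, a'⟩ := stm_eq_iff.2 h'
  refine ⟨l', (hA R _ (l.ty A)).unique (sty_eq_iff.1 ?_) (sty_eq_iff.1 rfl), ?_, by simp, ?_⟩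
  · change Hom.sty l' ⟨i.functor.obj Γ, i.ty A⟩ = Hom.sty l ⟨Γ, A⟩
    rw [← ha]
    change Hom.sty l' (stp ⟨i.functor.obj Γ, a⟩) = _
    rw [← Hom.stp_stm, h'']
    simp only [stp, ha']
  · refine (hfree B _ (g.tm a)).unique (stm_eq_iff.1 ?_) (stm_eq_iff.1 rfl)
    change Hom.stm F (Hom.stm l' ⟨i.functor.obj Γ, a⟩) = Hom.stm g ⟨_, a⟩
    rw [h'', hF]
  · rintro x rfl
    rw [h'']
    exact hP

theorem hasCells_coproducts {X Y : CwF.{u}} (i : X ⟶ Y)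
    (hi : MorphismProperty.coproducts.{u} genI i) : ∃ CT CM, HasCells i CT CM := by
  rw [MorphismProperty.coproducts_iff] at hi
  obtain ⟨J, ⟨X₁, X₂, c₁, c₂, h₁, h₂, f, hf⟩⟩ := hi
  have hcell : ∀ j, ∃ CT CM, HasCells (f.app j) CT CM := fun j =>
    (hf j).elim (hasCells_genTy _) (hasCells_genTm _)
  choose CT CM hc using hcell
  refine ⟨{x | ∃ j, ∃ y ∈ CT j, Hom.sty (c₂.ι.app j) y = x},
    {x | ∃ j, ∃ y ∈ CM j, Hom.stm (c₂.ι.app j) y = x}, ?_⟩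
  intro R B F g l PT PM sq hL
  have key : ∀ j, ∃ l' : X₂.obj j ⟶ R, f.app j ≫ l' = c₁.ι.app j ≫ l ∧
      l' ≫ F = c₂.ι.app j ≫ g ∧
      (∀ x ∈ CT j, PT (Hom.sty (c₂.ι.app j) x) (Hom.sty l' x)) ∧
      ∀ x ∈ CM j, PM (Hom.stm (c₂.ι.app j) x) (Hom.stm l' x) := by
    intro j
    refine hc j F (c₂.ι.app j ≫ g) (c₁.ι.app j ≫ l)
      (fun x y => PT (Hom.sty (c₂.ι.app j) x) y) (fun x y => PM (Hom.stm (c₂.ι.app j) x) y) ?_ ?_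
    · rw [Category.assoc, sq, ← Category.assoc, h₁.fac]
      simp
    · refine ⟨fun x hx G hG => hL.liftTy _ ⟨j, x, hx, rfl⟩ G hG, fun x hx y hy => ?_⟩
      refine hL.liftTm _ ⟨j, x, hx, rfl⟩ y ?_
      rw [Hom.stp_stm]
      exact hy
  choose l' h1 h2 h3 h4 using key
  let s : Cocone X₂ := Cocone.mk R (Discrete.natTrans l')
  have hs : ∀ j, c₂.ι.app j ≫ h₂.desc s = l' j := fun j => h₂.fac s j
  refine ⟨h₂.desc s, ?_, ?_, ?_, ?_⟩
  · refine h₁.hom_ext fun j => ?_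
    rw [← Category.assoc, h₁.fac]
    simp [hs, h1]
  · refine h₂.hom_ext fun j => ?_
    rw [← Category.assoc, hs, h2]
  · rintro x ⟨j, y, hy, rfl⟩
    rw [← Hom.sty_comp, hs]
    exact h3 j y hy
  · rintro x ⟨j, y, hy, rfl⟩
    rw [← Hom.stm_comp, hs]
    exact h4 j y hy

theorem hasCells_basicCellular {X Y : CwF.{u}} (i : X ⟶ Y) (hi : basicCellular i) :
    ∃ CT CM, HasCells i CT CM := by
  obtain ⟨A, B₀, p, f, g₀, hp, po⟩ := hi
  obtain ⟨CT, CM, hc⟩ := hasCells_coproducts p hp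
  refine ⟨{x | ∃ y ∈ CT, Hom.sty g₀ y = x}, {x | ∃ y ∈ CM, Hom.stm g₀ y = x}, ?_⟩
  intro R B F g l PT PM sq hL
  obtain ⟨l', h1, h2, h3, h4⟩ := hc F (g₀ ≫ g) (f ≫ l)
    (fun x y => PT (Hom.sty g₀ x) y) (fun x y => PM (Hom.stm g₀ x) y)
    (by rw [Category.assoc, sq, ← Category.assoc, po.w, Category.assoc])
    ⟨fun x hx G hG => hL.liftTy _ ⟨x, hx, rfl⟩ G hG, fun x hx y hy =>
      hL.liftTm _ ⟨x, hx, rfl⟩ y (by rw [Hom.stp_stm]; exact hy)⟩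
  refine ⟨po.desc l l' h1.symm, po.inl_desc _ _ _, ?_, ?_, ?_⟩
  · apply po.hom_ext
    · rw [← Category.assoc, po.inl_desc, sq]
    · rw [← Category.assoc, po.inr_desc, h2]
  · rintro x ⟨y, hy, rfl⟩
    rw [← Hom.sty_comp, po.inr_desc]
    exact h3 y hy
  · rintro x ⟨y, hy, rfl⟩
    rw [← Hom.stm_comp, po.inr_desc]
    exact h4 y hy

/-- `CT` and `CM` generate `C` freely: a morphism out of `C` can be lifted along `F` as soon as the
generators can. -/
def Generates (C : CwF.{u}) (CT : Set (Σ Γ, C.Ty Γ)) (CM : Set (Σ Γ, C.Tm Γ)) : Prop :=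
  ∀ ⦃R B : CwF.{u}⦄ (F : R ⟶ B) (g : C ⟶ B) (PT : (Σ Γ, C.Ty Γ) → (Σ Γ, R.Ty Γ) → Prop)
    (PM : (Σ Γ, C.Tm Γ) → (Σ Γ, R.Tm Γ) → Prop), LiftData CT CM F g PT PM →
    ∃ l : C ⟶ R, l ≫ F = g ∧ (∀ x ∈ CT, PT x (Hom.sty l x)) ∧ ∀ x ∈ CM, PM x (Hom.stm l x)

/-- The lift is built stage by stage, starting from the initial CwF. Each stage extends the previous
one strictly, so the chosen lifts form a cocone on the sequence and induce the lift on its colimit.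
-/
theorem IsCellular.exists_generators {C : CwF.{u}} (hC : C.IsCellular) :
    ∃ CT CM, Generates C CT CM := by
  obtain ⟨O, hO, ⟨h⟩⟩ := hC
  have hcell : ∀ n : ℕ, ∃ CT CM, HasCells (h.F.map (homOfLE (Nat.le_add_right n 1))) CT CM :=
    fun n => hasCells_basicCellular _ (h.map_mem n (not_isMax n))
  choose CT CM hc using hcell
  refine ⟨{x | ∃ n, ∃ y ∈ CT n, Hom.sty (h.incl.app (n + 1)) y = x},
    {x | ∃ n, ∃ y ∈ CM n, Hom.stm (h.incl.app (n + 1)) y = x}, ?_⟩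
  intro R B F g PT PM hL
  have step : ∀ (n : ℕ) (l : h.F.obj n ⟶ R), l ≫ F = h.incl.app n ≫ g →
      ∃ l' : h.F.obj (n + 1) ⟶ R, l' ≫ F = h.incl.app (n + 1) ≫ g ∧
        h.F.map (homOfLE (Nat.le_add_right n 1)) ≫ l' = l ∧
        (∀ x ∈ CT n, PT (Hom.sty (h.incl.app (n + 1)) x) (Hom.sty l' x)) ∧
        ∀ x ∈ CM n, PM (Hom.stm (h.incl.app (n + 1)) x) (Hom.stm l' x) := by
    intro n l hl
    obtain ⟨l', h1, h2, h3, h4⟩ := hc n F (h.incl.app (n + 1) ≫ g) l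
      (fun x y => PT (Hom.sty (h.incl.app (n + 1)) x) y)
      (fun x y => PM (Hom.stm (h.incl.app (n + 1)) x) y)
      (by
        rw [hl, ← Category.assoc, h.incl.naturality]
        simp)
      ⟨fun x hx G hG => hL.liftTy _ ⟨n, x, hx, rfl⟩ G hG, fun x hx y hy =>
        hL.liftTm _ ⟨n, x, hx, rfl⟩ y (by rw [Hom.stp_stm]; exact hy)⟩
    exact ⟨l', h2, h1, h3, h4⟩
  have base : ∃ l : h.F.obj 0 ⟶ R, l ≫ F = h.incl.app 0 ≫ g := by
    have hb : IsInitial (h.F.obj 0) := hO.ofIso h.isoBot.symm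
    exact ⟨hb.to R, hb.hom_ext _ _⟩
  choose next hn1 hn2 hn3 hn4 using step
  obtain ⟨l₀, hl₀⟩ := base
  let seq : ∀ n : ℕ, {l : h.F.obj n ⟶ R // l ≫ F = h.incl.app n ≫ g} := fun n =>
    Nat.rec ⟨l₀, hl₀⟩ (fun n l => ⟨next n l.1 l.2, hn1 n l.1 l.2⟩) n
  let s : Cocone h.F := Cocone.mk R (NatTrans.ofSequence (fun n => (seq n).1) (by
    intro n
    refine (hn2 n (seq n).1 (seq n).2).trans ?_
    simp))
  have hs : ∀ n, h.incl.app n ≫ h.isColimit.desc s = (seq n).1 := fun n => h.isColimit.fac s n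
  refine ⟨h.isColimit.desc s, ?_, ?_, ?_⟩
  · refine h.isColimit.hom_ext fun n => ?_
    change h.incl.app n ≫ h.isColimit.desc s ≫ F = _
    rw [← Category.assoc, hs, (seq n).2]
  · rintro x ⟨n, y, hy, rfl⟩
    rw [← Hom.sty_comp]
    refine (congrArg (fun k => PT _ (Hom.sty k y)) (hs (n + 1))).mpr ?_
    exact hn3 n (seq n).1 (seq n).2 y hy
  · rintro x ⟨n, y, hy, rfl⟩
    rw [← Hom.stm_comp]
    refine (congrArg (fun k => PM _ (Hom.stm k y)) (hs (n + 1))).mpr ?_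
    exact hn4 n (seq n).1 (seq n).2 y hy

/-! ### The terminal CwF -/

/-- The CwF with one context, one type and one term. -/
def point : CwF.{u} where
  Ctx := Discrete PUnit
  empty := ⟨⟨⟩⟩
  emptyIsTerminal := IsTerminal.ofUniqueHom (fun _ => Discrete.eqToHom rfl)
    (fun _ _ => Subsingleton.elim _ _)
  Ty _ := PUnit
  tySub _ _ := ⟨⟩
  tySub_id _ := rfl
  tySub_comp _ _ _ := rfl
  Tm _ := PUnit
  tmSub _ _ := ⟨⟩
  tmSub_id _ := rfl
  tmSub_comp _ _ _ := rfl
  tp _ := ⟨⟩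
  tp_tmSub _ _ := rfl
  ext _ := ⟨⟨⟩⟩
  p _ := Discrete.eqToHom rfl
  q _ := ⟨⟩
  tp_q _ := rfl
  pair _ _ _ _ := Discrete.eqToHom rfl
  pair_p _ _ _ _ := Subsingleton.elim _ _
  pair_q _ _ _ _ := rfl
  ext_hom_ext _ _ _ _ _ := Subsingleton.elim _ _

/-- The morphism to the terminal CwF. -/
def toPoint (C : CwF.{u}) : C ⟶ point where
  functor := (Functor.const _).obj ⟨⟨⟩⟩
  ty _ := ⟨⟩
  ty_sub _ _ := rfl
  tm _ := ⟨⟩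
  tm_sub _ _ := rfl
  tp_tm _ := rfl
  obj_empty := rfl
  obj_ext _ := rfl
  map_p _ := Subsingleton.elim (α := (⟨⟨⟩⟩ : Discrete PUnit) ⟶ ⟨⟨⟩⟩) _ _
  tm_q _ := rfl

/-! ### The contextual core -/

/-- Presentations of a context as an iterated extension of the empty context. -/
inductive Con (C : CwF.{u}) : C.Ctx → Type u
  | nil : Con C C.empty
  | snoc {Γ : C.Ctx} (c : Con C Γ) (A : C.Ty Γ) : Con C (C.ext A)

/-- A context with a presentation as an iterated extension of the empty context. -/
structure ConCtx (C : CwF.{u}) : Type u where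
  ctx : C.Ctx
  con : Con C ctx

instance (C : CwF.{u}) : SmallCategory (ConCtx C) where
  Hom X Y := X.ctx ⟶ Y.ctx
  id X := 𝟙 X.ctx
  comp f g := f ≫ g
  id_comp f := Category.id_comp (X := _) f
  comp_id f := Category.comp_id (X := _) f
  assoc f g h := Category.assoc (W := _) f g h

/-- The CwF of the contexts of `C` that are presented as iterated extensions. -/
def core (C : CwF.{u}) : CwF.{u} where
  Ctx := ConCtx C
  empty := ⟨C.empty, .nil⟩
  emptyIsTerminal := IsTerminal.ofUniqueHom (fun X => C.emptyIsTerminal.from X.ctx)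
    (fun _ _ => C.emptyIsTerminal.hom_ext _ _)
  Ty X := C.Ty X.ctx
  tySub σ A := C.tySub σ A
  tySub_id A := C.tySub_id A
  tySub_comp τ σ A := C.tySub_comp τ σ A
  Tm X := C.Tm X.ctx
  tmSub σ a := C.tmSub σ a
  tmSub_id a := C.tmSub_id a
  tmSub_comp τ σ a := C.tmSub_comp τ σ a
  tp a := C.tp a
  tp_tmSub σ a := C.tp_tmSub σ a
  ext {X} A := ⟨C.ext A, X.con.snoc A⟩
  p A := C.p A
  q A := C.q A
  tp_q A := C.tp_q A
  pair σ A a h := C.pair σ A a h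
  pair_p σ A a h := C.pair_p σ A a h
  pair_q σ A a h := C.pair_q σ A a h
  ext_hom_ext A θ κ hp hq := C.ext_hom_ext A θ κ hp hq

/-- The forgetful morphism from the contextual core. -/
def ofCore (C : CwF.{u}) : core C ⟶ C where
  functor :=
    { obj := fun X => X.ctx
      map := fun f => f
      map_id := fun _ => rfl
      map_comp := fun _ _ => rfl }
  ty A := A
  ty_sub _ _ := rfl
  tm a := a
  tm_sub _ _ := rfl
  tp_tm _ := rfl
  obj_empty := rfl
  obj_ext _ := rfl
  map_p A := (Category.id_comp (C.p A)).symm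
  tm_q A := (C.tmSub_id (C.q A)).symm

/-! ### Sub-CwFs with all contexts -/

/-- Closure conditions on classes of types, terms and substitutions. -/
structure Closed (C : CwF.{u}) (PT : ∀ {Γ : C.Ctx}, C.Ty Γ → Prop)
    (PM : ∀ {Γ : C.Ctx}, C.Tm Γ → Prop) (PH : ∀ {Δ Γ : C.Ctx}, (Δ ⟶ Γ) → Prop) : Prop where
  id : ∀ Γ, PH (𝟙 Γ)
  comp : ∀ {Θ Δ Γ : C.Ctx} (τ : Θ ⟶ Δ) (σ : Δ ⟶ Γ), PH τ → PH σ → PH (τ ≫ σ)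
  empty : ∀ {Γ : C.Ctx} (σ : Γ ⟶ C.empty), PH σ
  tySub : ∀ {Δ Γ : C.Ctx} (σ : Δ ⟶ Γ) (A : C.Ty Γ), PH σ → PT A → PT (C.tySub σ A)
  tmSub : ∀ {Δ Γ : C.Ctx} (σ : Δ ⟶ Γ) (a : C.Tm Γ), PH σ → PM a → PM (C.tmSub σ a)
  p : ∀ {Γ : C.Ctx} (A : C.Ty Γ), PH (C.p A)
  q : ∀ {Γ : C.Ctx} (A : C.Ty Γ), PM (C.q A)
  pair : ∀ {Γ Δ : C.Ctx} (σ : Δ ⟶ Γ) (A : C.Ty Γ) (a : C.Tm Δ) (h : C.tp a = C.tySub σ A),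
    PH σ → PM a → PH (C.pair σ A a h)

section Sub

variable {C : CwF.{u}} {PT : ∀ {Γ : C.Ctx}, C.Ty Γ → Prop}
  {PM : ∀ {Γ : C.Ctx}, C.Tm Γ → Prop} {PH : ∀ {Δ Γ : C.Ctx}, (Δ ⟶ Γ) → Prop}

/-- The contexts of a sub-CwF. -/
structure SubCtx (h : Closed C PT PM PH) : Type u where
  ctx : C.Ctx

instance (h : Closed C PT PM PH) : SmallCategory (SubCtx h) where
  Hom X Y := {σ : X.ctx ⟶ Y.ctx // PH σ}
  id X := ⟨𝟙 X.ctx, h.id _⟩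
  comp f g := ⟨f.1 ≫ g.1, h.comp _ _ f.2 g.2⟩
  id_comp f := Subtype.ext (Category.id_comp f.1)
  comp_id f := Subtype.ext (Category.comp_id f.1)
  assoc f g k := Subtype.ext (Category.assoc f.1 g.1 k.1)

/-- The sub-CwF of the given types, terms and substitutions. -/
def sub (h : Closed C PT PM PH) : CwF.{u} where
  Ctx := SubCtx h
  empty := ⟨C.empty⟩
  emptyIsTerminal := IsTerminal.ofUniqueHom
    (fun X => Subtype.mk (C.emptyIsTerminal.from X.ctx) (h.empty _))
    (fun _ _ => Subtype.ext (C.emptyIsTerminal.hom_ext _ _))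
  Ty X := {A : C.Ty X.ctx // PT A}
  tySub σ A := ⟨C.tySub σ.1 A.1, h.tySub _ _ σ.2 A.2⟩
  tySub_id A := Subtype.ext (C.tySub_id A.1)
  tySub_comp τ σ A := Subtype.ext (C.tySub_comp τ.1 σ.1 A.1)
  -- The type of a kept term must be kept as well, so that `tp` restricts.
  Tm X := {a : C.Tm X.ctx // PM a ∧ PT (C.tp a)}
  tmSub σ a := ⟨C.tmSub σ.1 a.1, h.tmSub _ _ σ.2 a.2.1, by
    rw [C.tp_tmSub]; exact h.tySub _ _ σ.2 a.2.2⟩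
  tmSub_id a := Subtype.ext (C.tmSub_id a.1)
  tmSub_comp τ σ a := Subtype.ext (C.tmSub_comp τ.1 σ.1 a.1)
  tp a := ⟨C.tp a.1, a.2.2⟩
  tp_tmSub σ a := Subtype.ext (C.tp_tmSub σ.1 a.1)
  ext A := ⟨C.ext A.1⟩
  p A := ⟨C.p A.1, h.p _⟩
  q A := ⟨C.q A.1, h.q _, by rw [C.tp_q]; exact h.tySub _ _ (h.p _) A.2⟩
  tp_q A := Subtype.ext (C.tp_q A.1)
  pair σ A a e := ⟨C.pair σ.1 A.1 a.1 (congrArg Subtype.val e), h.pair _ _ _ _ σ.2 a.2.1⟩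
  pair_p σ A a e := Subtype.ext (C.pair_p σ.1 A.1 a.1 _)
  pair_q σ A a e := Subtype.ext (C.pair_q σ.1 A.1 a.1 _)
  ext_hom_ext A θ κ hp hq := Subtype.ext
    (C.ext_hom_ext A.1 θ.1 κ.1 (congrArg Subtype.val hp) (congrArg Subtype.val hq))

/-- The inclusion of a sub-CwF. -/
def ofSub (h : Closed C PT PM PH) : sub h ⟶ C where
  functor :=
    { obj := fun X => X.ctx
      map := fun f => f.1
      map_id := fun _ => rfl
      map_comp := fun _ _ => rfl }
  ty A := A.1
  ty_sub _ _ := rfl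
  tm a := a.1
  tm_sub _ _ := rfl
  tp_tm _ := rfl
  obj_empty := rfl
  obj_ext _ := rfl
  map_p A := (Category.id_comp (C.p A.1)).symm
  tm_q A := (C.tmSub_id (C.q A.1)).symm

end Sub

end CwF

/-! ### Raw syntax -/

/-- Raw expressions over a set of symbols, with de Bruijn levels as variables. The arguments of a
symbol are padded by `bot`. -/
inductive Raw (S : Type u) : Type u
  | bot : Raw S
  | var : ℕ → Raw S
  | app : S → (ℕ → Raw S) → Raw S

namespace Raw

variable {S : Type u}

/-- Simultaneous substitution. -/
def subst (r : ℕ → Raw S) : Raw S → Raw S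
  | bot => bot
  | var i => r i
  | app s a => app s fun i => (a i).subst r

/-- The variable `i` occurs. -/
def Occ (i : ℕ) : Raw S → Prop
  | bot => False
  | var j => i = j
  | app _ a => ∃ k, (a k).Occ i

/-- All variables are less than `n`. -/
def Scoped (n : ℕ) (t : Raw S) : Prop := ∀ i, t.Occ i → i < n

/-- The identity substitution on `n` variables. -/
def idn (S : Type u) (n : ℕ) : ℕ → Raw S := fun i => if i < n then var i else bot

theorem idn_of_lt {n i : ℕ} (h : i < n) : idn S n i = var i := if_pos h

theorem idn_of_le {n i : ℕ} (h : n ≤ i) : idn S n i = bot := if_neg (Nat.not_lt.2 h)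

theorem subst_congr {r r' : ℕ → Raw S} (t : Raw S) (h : ∀ i, t.Occ i → r i = r' i) :
    t.subst r = t.subst r' := by
  induction t with
  | bot => rfl
  | var i => exact h i rfl
  | app s a ih =>
    simp only [subst]
    congr 1
    funext k
    exact ih k fun i hi => h i ⟨k, hi⟩

theorem subst_var (t : Raw S) : t.subst var = t := by
  induction t with
  | bot => rfl
  | var i => rfl
  | app s a ih => simp only [subst, ih]

theorem subst_idn {n : ℕ} {t : Raw S} (h : t.Scoped n) : t.subst (idn S n) = t := by
  conv_rhs => rw [← subst_var t]
  exact subst_congr t fun i hi => idn_of_lt (h i hi)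

theorem subst_subst (r r' : ℕ → Raw S) (t : Raw S) :
    (t.subst r).subst r' = t.subst fun i => (r i).subst r' := by
  induction t with
  | bot => rfl
  | var i => rfl
  | app s a ih => simp only [subst, ih]

theorem occ_subst {r : ℕ → Raw S} {t : Raw S} {j : ℕ} :
    (t.subst r).Occ j ↔ ∃ i, t.Occ i ∧ (r i).Occ j := by
  induction t with
  | bot => simp [subst, Occ]
  | var i => simp [subst, Occ]
  | app s a ih =>
    simp only [subst, Occ, ih]
    constructor
    · rintro ⟨k, i, h, h'⟩
      exact ⟨i, ⟨k, h⟩, h'⟩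
    · rintro ⟨i, ⟨k, h⟩, h'⟩
      exact ⟨k, i, h, h'⟩

theorem scoped_subst {m : ℕ} {r : ℕ → Raw S} (h : ∀ i, (r i).Scoped m) (t : Raw S) :
    (t.subst r).Scoped m := by
  intro j hj
  obtain ⟨i, -, hi⟩ := occ_subst.1 hj
  exact h i j hi

theorem scoped_bot {n : ℕ} : (bot : Raw S).Scoped n := fun _ h => h.elim

theorem scoped_idn {n m : ℕ} (h : n ≤ m) (i : ℕ) : (idn S n i).Scoped m := by
  unfold idn
  split
  · rename_i hi
    rintro j rfl
    omega
  · exact scoped_bot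

end Raw

/-- The contexts of the CwF of raw expressions: numbers of variables. -/
structure RawCtx (S : Type u) : Type u where
  len : ℕ

namespace RawCtx

variable {S : Type u}

/-- Substitutions: sequences of raw expressions, padded by `bot`. -/
@[ext]
structure Hom (m n : RawCtx S) : Type u where
  val : ℕ → Raw S
  isScoped : ∀ i, (val i).Scoped m.len
  pad : ∀ i, n.len ≤ i → val i = .bot

instance : SmallCategory (RawCtx S) where
  Hom := Hom
  id n := ⟨Raw.idn S n.len, Raw.scoped_idn le_rfl, fun _ => Raw.idn_of_le⟩
  comp f g := ⟨fun i => (g.val i).subst f.val, fun i => Raw.scoped_subst f.isScoped _,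
    fun i hi => by rw [g.pad i hi]; rfl⟩
  id_comp f := by
    ext i
    exact Raw.subst_idn (f.isScoped i)
  comp_id {m n} f := by
    ext i
    change (Raw.idn S n.len i).subst f.val = f.val i
    by_cases hi : i < n.len
    · rw [Raw.idn_of_lt hi]; rfl
    · rw [Raw.idn_of_le (Nat.le_of_not_lt hi), f.pad i (Nat.le_of_not_lt hi)]; rfl
  assoc f g h := by
    ext i
    exact (Raw.subst_subst _ _ _).symm

theorem val_eqToHom {m n : RawCtx S} (h : m = n) : Hom.val (eqToHom h) = Raw.idn S m.len := by
  subst h; rfl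

end RawCtx

/-- The CwF of raw expressions: a raw term of any raw type is allowed. -/
def rawCwF (S : Type u) : CwF.{u} where
  Ctx := RawCtx S
  empty := ⟨0⟩
  emptyIsTerminal := IsTerminal.ofUniqueHom
    (fun _ => RawCtx.Hom.mk (fun _ => .bot) (fun _ => Raw.scoped_bot) fun _ _ => rfl)
    (fun _ m => RawCtx.Hom.ext (funext fun i => m.pad i (Nat.zero_le i)))
  Ty n := {A : Raw S // A.Scoped n.len}
  tySub σ A := ⟨A.1.subst σ.val, Raw.scoped_subst σ.isScoped _⟩
  tySub_id A := Subtype.ext (Raw.subst_idn A.2)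
  tySub_comp τ σ A := Subtype.ext (Raw.subst_subst _ _ _).symm
  -- A raw term carries its type as a second component, so no typing judgement is needed.
  Tm n := {A : Raw S // A.Scoped n.len} × {A : Raw S // A.Scoped n.len}
  tmSub σ a := ⟨⟨a.1.1.subst σ.val, Raw.scoped_subst σ.isScoped _⟩,
    ⟨a.2.1.subst σ.val, Raw.scoped_subst σ.isScoped _⟩⟩
  tmSub_id a := Prod.ext (Subtype.ext (Raw.subst_idn a.1.2)) (Subtype.ext (Raw.subst_idn a.2.2))
  tmSub_comp τ σ a := Prod.ext (Subtype.ext (Raw.subst_subst _ _ _).symm)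
    (Subtype.ext (Raw.subst_subst _ _ _).symm)
  tp a := a.2
  tp_tmSub _ _ := rfl
  ext {n} _ := ⟨n.len + 1⟩
  p {n} _ := ⟨Raw.idn S n.len, Raw.scoped_idn (Nat.le_succ _), fun _ => Raw.idn_of_le⟩
  q {n} A := ⟨⟨.var n.len, by rintro i rfl; exact Nat.lt_succ_self _⟩,
    ⟨A.1.subst (Raw.idn S n.len), Raw.scoped_subst (Raw.scoped_idn (Nat.le_succ _)) _⟩⟩
  tp_q _ := rfl
  pair {n m} σ _ a _ := ⟨Function.update σ.val n.len a.1.1, by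
      intro i
      by_cases h : i = n.len
      · subst h; rw [Function.update_self]; exact a.1.2
      · rw [Function.update_of_ne h]; exact σ.isScoped i, by
      intro i hi
      have hi : n.len + 1 ≤ i := hi
      rw [Function.update_of_ne (by omega)]
      exact σ.pad i (by omega)⟩
  pair_p {n m} σ A a h := by
    apply RawCtx.Hom.ext
    funext i
    change (Raw.idn S n.len i).subst (Function.update σ.val n.len a.1.1) = σ.val i
    by_cases hi : i < n.len
    · rw [Raw.idn_of_lt hi]
      exact Function.update_of_ne (by omega) _ _
    · rw [Raw.idn_of_le (Nat.le_of_not_lt hi), σ.pad i (Nat.le_of_not_lt hi)]; rfl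
  pair_q {n m} σ A a h := by
    refine Prod.ext (Subtype.ext (Function.update_self _ _ _)) ?_
    refine Eq.trans (Subtype.ext ?_) h.symm
    change (A.1.subst (Raw.idn S n.len)).subst (Function.update σ.val n.len a.1.1) =
      A.1.subst σ.val
    rw [Raw.subst_idn A.2]
    refine Raw.subst_congr _ fun i hi => Function.update_of_ne ?_ _ _
    exact Nat.ne_of_lt (A.2 i hi)
  ext_hom_ext {n m} A θ θ' h h' := by
    apply RawCtx.Hom.ext
    funext i
    rcases lt_trichotomy i n.len with hi | rfl | hi
    · have := congrFun (congrArg RawCtx.Hom.val h) i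
      change (Raw.idn S n.len i).subst θ.val = (Raw.idn S n.len i).subst θ'.val at this
      rwa [Raw.idn_of_lt hi] at this
    · exact congrArg (fun x => x.1.1) h'
    · rw [θ.pad i hi, θ'.pad i hi]

namespace CwF

/-! ### Presentations of cellular CwFs -/

/-- The variables of a presented context. -/
def Con.IsVar {C : CwF.{u}} : {Γ : C.Ctx} → Con C Γ → C.Tm Γ → Prop
  | _, .nil, _ => False
  | _, .snoc c A, a => a = C.q A ∨ ∃ b, c.IsVar b ∧ a = C.tmSub (C.p A) b

/-- The symbols: one for each type and one for each term (only generators are used). -/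
abbrev Sym (C : CwF.{u}) : Type u := (Σ Γ, C.Ty Γ) ⊕ (Σ Γ, C.Tm Γ)

/-- A presentation of a CwF by type symbols `CT` and term symbols `CM`, subject to no equations:
every context is an iterated extension, every type is a substituted type symbol, every term is
a variable or a substituted term symbol, and there is an interpretation in raw expressions. -/
structure Presentation (C : CwF.{u}) : Type (u + 1) where
  CT : Set (Σ Γ, C.Ty Γ)
  CM : Set (Σ Γ, C.Tm Γ)
  con : ∀ Γ, Con C Γ
  con_empty : con C.empty = .nil
  con_ext : ∀ {Γ : C.Ctx} (A : C.Ty Γ), con (C.ext A) = (con Γ).snoc A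
  raw : C ⟶ rawCwF (Sym C)
  raw_ty : ∀ x ∈ CT, (raw.ty x.2).1 = .app (.inl x) (Raw.idn _ (raw.functor.obj x.1).len)
  raw_tm : ∀ x ∈ CM, (raw.tm x.2).1.1 = .app (.inr x) (Raw.idn _ (raw.functor.obj x.1).len)
  gen_ty : ∀ {Γ : C.Ctx} (A : C.Ty Γ), ∃ x ∈ CT, ∃ σ : Γ ⟶ x.1, A = C.tySub σ x.2
  gen_tm : ∀ {Γ : C.Ctx} (a : C.Tm Γ),
    (con Γ).IsVar a ∨ ∃ x ∈ CM, ∃ σ : Γ ⟶ x.1, a = C.tmSub σ x.2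

/-- The core has the same types and terms over each context as C, so every generator lifts and the
forgetful morphism has a section. The section chooses a presentation of each context, and strictness
makes the choice compatible with extensions. -/
theorem Generates.exists_con {C : CwF.{u}} {CT : Set (Σ Γ, C.Ty Γ)} {CM : Set (Σ Γ, C.Tm Γ)}
    (h : Generates C CT CM) :
    ∃ con : ∀ Γ, Con C Γ, con C.empty = .nil ∧
      ∀ {Γ : C.Ctx} (A : C.Ty Γ), con (C.ext A) = (con Γ).snoc A := by
  obtain ⟨l, hl, -, -⟩ := h (ofCore C) (𝟙 C) (fun _ _ => True) (fun _ _ => True)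
    { liftTy := by
        rintro ⟨Γ, A⟩ - G hG
        obtain rfl : G.ctx = Γ := hG
        exact ⟨A, rfl, trivial⟩
      liftTm := by
        rintro ⟨Γ, a⟩ - ⟨G, B⟩ hy
        change (⟨G.ctx, B⟩ : Σ Γ, C.Ty Γ) = ⟨Γ, C.tp a⟩ at hy
        obtain rfl : G.ctx = Γ := congrArg Sigma.fst hy
        obtain rfl : B = C.tp a := eq_of_heq (Sigma.mk.inj hy).2
        exact ⟨a, rfl, rfl, trivial⟩ }
  have hctx : ∀ Γ, (l.functor.obj Γ).ctx = Γ := fun Γ =>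
    congrArg (fun k : C ⟶ C => k.functor.obj Γ) hl
  have hty : ∀ {Γ : C.Ctx} (A : C.Ty Γ), (⟨(l.functor.obj Γ).ctx, l.ty A⟩ : Σ Γ, C.Ty Γ) = ⟨Γ, A⟩ :=
    fun A => congrArg (fun k : C ⟶ C => Hom.sty k ⟨_, A⟩) hl
  have hcon : ∀ (X : ConCtx C) (Γ : C.Ctx) (e : X.ctx = Γ) (c : Con C Γ),
      X = ⟨Γ, c⟩ → e ▸ X.con = c := by
    rintro X Γ e c rfl
    rfl
  refine ⟨fun Γ => hctx Γ ▸ (l.functor.obj Γ).con, hcon _ _ _ _ l.obj_empty, fun {Γ} A => ?_⟩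
  refine hcon _ _ _ _ ((l.obj_ext A).trans ?_)
  have key : ∀ (X : ConCtx C) (B : C.Ty X.ctx) (e : X.ctx = Γ),
      (⟨X.ctx, B⟩ : Σ Γ, C.Ty Γ) = ⟨Γ, A⟩ →
      (⟨C.ext B, X.con.snoc B⟩ : ConCtx C) = ⟨C.ext A, (e ▸ X.con).snoc A⟩ := by
    rintro ⟨Γ', c⟩ B e h
    cases h
    rfl
  exact key _ _ _ (hty A)

/-- Over the terminal CwF the lifts of generators are unconstrained apart from the type of a term,
which raw terms may have arbitrarily. Each generator can thus go to its own symbol, applied to all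
the variables of its context. -/
theorem Generates.exists_raw {C : CwF.{u}} {CT : Set (Σ Γ, C.Ty Γ)} {CM : Set (Σ Γ, C.Tm Γ)}
    (h : Generates C CT CM) :
    ∃ raw : C ⟶ rawCwF (Sym C),
      (∀ x ∈ CT, (raw.ty x.2).1 = .app (.inl x) (Raw.idn _ (raw.functor.obj x.1).len)) ∧
      ∀ x ∈ CM, (raw.tm x.2).1.1 = .app (.inr x) (Raw.idn _ (raw.functor.obj x.1).len) := by
  have hsc : ∀ (s : Sym C) (n : ℕ), (Raw.app s (Raw.idn _ n)).Scoped n := by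
    rintro s n i ⟨k, hk⟩
    exact Raw.scoped_idn le_rfl k i hk
  obtain ⟨l, -, h1, h2⟩ := h (toPoint (rawCwF (Sym C))) (toPoint C)
    (fun x y => y.2.1 = .app (.inl x) (Raw.idn _ y.1.len))
    (fun x y => y.2.1.1 = .app (.inr x) (Raw.idn _ y.1.len))
    { liftTy := fun x _ G _ => ⟨⟨_, hsc (.inl x) G.len⟩, rfl, rfl⟩
      liftTm := fun x _ y _ => ⟨⟨⟨_, hsc (.inr x) y.1.len⟩, y.2⟩, rfl, rfl, rfl⟩ }
  exact ⟨l, h1, h2⟩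

/-- The types and terms of the required forms make up a sub-CwF containing the generators. Its
inclusion therefore has a section, so it is everything. -/
theorem Generates.forms {C : CwF.{u}} {CT : Set (Σ Γ, C.Ty Γ)} {CM : Set (Σ Γ, C.Tm Γ)}
    (h : Generates C CT CM) (con : ∀ Γ, Con C Γ) (con_empty : con C.empty = .nil)
    (con_ext : ∀ {Γ : C.Ctx} (A : C.Ty Γ), con (C.ext A) = (con Γ).snoc A) :
    (∀ {Γ : C.Ctx} (A : C.Ty Γ), ∃ x ∈ CT, ∃ σ : Γ ⟶ x.1, A = C.tySub σ x.2) ∧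
    ∀ {Γ : C.Ctx} (a : C.Tm Γ),
      (con Γ).IsVar a ∨ ∃ x ∈ CM, ∃ σ : Γ ⟶ x.1, a = C.tmSub σ x.2 := by
  let PT : ∀ {Γ : C.Ctx}, C.Ty Γ → Prop := fun {Γ} A => ∃ x ∈ CT, ∃ σ : Γ ⟶ x.1, A = C.tySub σ x.2
  let PM : ∀ {Γ : C.Ctx}, C.Tm Γ → Prop := fun {Γ} a =>
    (con Γ).IsVar a ∨ ∃ x ∈ CM, ∃ σ : Γ ⟶ x.1, a = C.tmSub σ x.2
  -- A condition on variables alone suffices: an instance of a symbol stays one under any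
  -- substitution.
  let PH : ∀ {Δ Γ : C.Ctx}, (Δ ⟶ Γ) → Prop := fun {Δ Γ} σ =>
    ∀ a, (con Γ).IsVar a → PM (C.tmSub σ a)
  have hsub : ∀ {Δ Γ : C.Ctx} (σ : Δ ⟶ Γ) (a : C.Tm Γ), PH σ → PM a → PM (C.tmSub σ a) := by
    rintro Δ Γ σ a hσ (ha | ⟨x, hx, τ, rfl⟩)
    · exact hσ a ha
    · exact Or.inr ⟨x, hx, σ ≫ τ, (C.tmSub_comp _ _ _).symm⟩
  have hcl : Closed C PT PM PH :=
    { id := fun Γ a ha => Or.inl (by rwa [C.tmSub_id])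
      comp := fun τ σ hτ hσ a ha => by
        rw [C.tmSub_comp]
        exact hsub τ _ hτ (hσ a ha)
      empty := fun σ a ha => by
        rw [con_empty] at ha
        exact ha.elim
      tySub := by
        rintro Δ Γ σ A - ⟨x, hx, τ, rfl⟩
        exact ⟨x, hx, σ ≫ τ, (C.tySub_comp _ _ _).symm⟩
      tmSub := hsub
      p := fun A a ha => Or.inl (by
        rw [con_ext]
        exact Or.inr ⟨a, ha, rfl⟩)
      q := fun A => Or.inl (by
        rw [con_ext]
        exact Or.inl rfl)
      pair := fun σ A a e hσ ha b hb => by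
        rw [con_ext] at hb
        obtain rfl | ⟨b, hb, rfl⟩ := hb
        · rwa [C.pair_q]
        · rw [← C.tmSub_comp, C.pair_p]
          exact hσ b hb }
  have hgT : ∀ x ∈ CT, PT x.2 := fun x hx => ⟨x, hx, 𝟙 _, (C.tySub_id _).symm⟩
  have hgM : ∀ x ∈ CM, PM x.2 := fun x hx => Or.inr ⟨x, hx, 𝟙 _, (C.tmSub_id _).symm⟩
  obtain ⟨l, hl, -, -⟩ := h (ofSub hcl) (𝟙 C) (fun _ _ => True) (fun _ _ => True)
    { liftTy := by
        rintro ⟨Γ, A⟩ hx G hG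
        obtain rfl : G.ctx = Γ := hG
        exact ⟨⟨A, hgT _ hx⟩, rfl, trivial⟩
      liftTm := by
        rintro ⟨Γ, a⟩ hx ⟨G, B⟩ hy
        change (⟨G.ctx, B.1⟩ : Σ Γ, C.Ty Γ) = ⟨Γ, C.tp a⟩ at hy
        obtain rfl : G.ctx = Γ := congrArg Sigma.fst hy
        have hB : B.1 = C.tp a := eq_of_heq (Sigma.mk.inj hy).2
        exact ⟨⟨a, hgM _ hx, hB ▸ B.2⟩, Subtype.ext hB.symm, rfl, trivial⟩ }
  constructor
  · intro Γ A
    have e : (⟨(l.functor.obj Γ).ctx, (l.ty A).1⟩ : Σ Γ, C.Ty Γ) = ⟨Γ, A⟩ :=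
      congrArg (fun k : C ⟶ C => Hom.sty k ⟨Γ, A⟩) hl
    have hP : (fun x : Σ Γ, C.Ty Γ => PT x.2) ⟨(l.functor.obj Γ).ctx, (l.ty A).1⟩ := (l.ty A).2
    rw [e] at hP
    exact hP
  · intro Γ a
    have e : (⟨(l.functor.obj Γ).ctx, (l.tm a).1⟩ : Σ Γ, C.Tm Γ) = ⟨Γ, a⟩ :=
      congrArg (fun k : C ⟶ C => Hom.stm k ⟨Γ, a⟩) hl
    have hP : (fun x : Σ Γ, C.Tm Γ => PM x.2) ⟨(l.functor.obj Γ).ctx, (l.tm a).1⟩ := (l.tm a).2.1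
    rw [e] at hP
    exact hP

theorem IsCellular.nonempty_presentation {C : CwF.{u}} (hC : C.IsCellular) :
    Nonempty (Presentation C) := by
  obtain ⟨CT, CM, h⟩ := hC.exists_generators
  obtain ⟨con, c1, c2⟩ := h.exists_con
  obtain ⟨raw, r1, r2⟩ := h.exists_raw
  obtain ⟨g1, g2⟩ := h.forms con c1 c2
  exact ⟨⟨CT, CM, con, c1, c2, raw, r1, r2, g1, g2⟩⟩

namespace Presentation

variable {C : CwF.{u}} (P : Presentation C)

theorem ctx_induction (P : Presentation C) {motive : C.Ctx → Prop} (empty : motive C.empty)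
    (ext : ∀ (Γ : C.Ctx) (A : C.Ty Γ), motive Γ → motive (C.ext A)) (Γ : C.Ctx) : motive Γ := by
  induction P.con Γ with
  | nil => exact empty
  | snoc c A ih => exact ext _ A ih

/-- The number of variables of a context. -/
def len (Γ : C.Ctx) : ℕ := (P.raw.functor.obj Γ).len

/-- The raw expression of a type. -/
def rTy {Γ : C.Ctx} (A : C.Ty Γ) : Raw (Sym C) := (P.raw.ty A).1

/-- The raw expression of a term. -/
def rTm {Γ : C.Ctx} (a : C.Tm Γ) : Raw (Sym C) := (P.raw.tm a).1.1

/-- The raw expressions of the components of a substitution. -/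
def rHom {Δ Γ : C.Ctx} (σ : Δ ⟶ Γ) : ℕ → Raw (Sym C) := RawCtx.Hom.val (P.raw.functor.map σ)

theorem len_empty : P.len C.empty = 0 := congrArg RawCtx.len P.raw.obj_empty

theorem len_ext {Γ : C.Ctx} (A : C.Ty Γ) : P.len (C.ext A) = P.len Γ + 1 :=
  congrArg RawCtx.len (P.raw.obj_ext A)

theorem scoped_rTy {Γ : C.Ctx} (A : C.Ty Γ) : (P.rTy A).Scoped (P.len Γ) := (P.raw.ty A).2

theorem scoped_rTm {Γ : C.Ctx} (a : C.Tm Γ) : (P.rTm a).Scoped (P.len Γ) := (P.raw.tm a).1.2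

theorem scoped_rHom {Δ Γ : C.Ctx} (σ : Δ ⟶ Γ) (i : ℕ) : (P.rHom σ i).Scoped (P.len Δ) :=
  RawCtx.Hom.isScoped (P.raw.functor.map σ) i

theorem rHom_of_le {Δ Γ : C.Ctx} (σ : Δ ⟶ Γ) {i : ℕ} (h : P.len Γ ≤ i) : P.rHom σ i = .bot :=
  RawCtx.Hom.pad (P.raw.functor.map σ) i h

theorem rHom_id (Γ : C.Ctx) : P.rHom (𝟙 Γ) = Raw.idn _ (P.len Γ) := by
  rw [rHom, P.raw.functor.map_id]; rfl

theorem rHom_comp {Θ Δ Γ : C.Ctx} (τ : Θ ⟶ Δ) (σ : Δ ⟶ Γ) (i : ℕ) :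
    P.rHom (τ ≫ σ) i = (P.rHom σ i).subst (P.rHom τ) := by
  rw [rHom, P.raw.functor.map_comp]; rfl

theorem rTy_sub {Δ Γ : C.Ctx} (σ : Δ ⟶ Γ) (A : C.Ty Γ) :
    P.rTy (C.tySub σ A) = (P.rTy A).subst (P.rHom σ) := by
  rw [rTy, P.raw.ty_sub]; rfl

theorem rTm_sub {Δ Γ : C.Ctx} (σ : Δ ⟶ Γ) (a : C.Tm Γ) :
    P.rTm (C.tmSub σ a) = (P.rTm a).subst (P.rHom σ) := by
  rw [rTm, P.raw.tm_sub]; rfl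

theorem rHom_p {Γ : C.Ctx} (A : C.Ty Γ) : P.rHom (C.p A) = Raw.idn _ (P.len Γ) := by
  rw [rHom, P.raw.map_p]
  refine (congrArg (fun r => fun i => (Raw.idn _ (P.len Γ) i).subst r)
    (RawCtx.val_eqToHom (P.raw.obj_ext A))).trans ?_
  funext i
  exact Raw.subst_idn (Raw.scoped_idn (by have := P.len_ext A; unfold len at this ⊢; omega) i)

theorem rTm_q {Γ : C.Ctx} (A : C.Ty Γ) : P.rTm (C.q A) = .var (P.len Γ) := by
  rw [rTm, P.raw.tm_q]
  refine (congrArg (fun r => (Raw.var (P.len Γ)).subst r)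
    (RawCtx.val_eqToHom (P.raw.obj_ext A))).trans ?_
  exact Raw.idn_of_lt (by have := P.len_ext A; unfold len at this ⊢; omega)

theorem rTy_wk {Γ : C.Ctx} (A B : C.Ty Γ) : P.rTy (C.tySub (C.p A) B) = P.rTy B := by
  rw [rTy_sub, rHom_p, Raw.subst_idn (P.scoped_rTy B)]

theorem rTm_wk {Γ : C.Ctx} (A : C.Ty Γ) (b : C.Tm Γ) : P.rTm (C.tmSub (C.p A) b) = P.rTm b := by
  rw [rTm_sub, rHom_p, Raw.subst_idn (P.scoped_rTm b)]

theorem rHom_comp_p {Δ Γ : C.Ctx} {A : C.Ty Γ} (σ : Δ ⟶ C.ext A) {i : ℕ} (hi : i < P.len Γ) :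
    P.rHom (σ ≫ C.p A) i = P.rHom σ i := by
  rw [rHom_comp, rHom_p, Raw.idn_of_lt hi]; rfl

theorem rTm_sub_q {Δ Γ : C.Ctx} {A : C.Ty Γ} (σ : Δ ⟶ C.ext A) :
    P.rTm (C.tmSub σ (C.q A)) = P.rHom σ (P.len Γ) := by
  rw [rTm_sub, rTm_q]; rfl

theorem rTy_gen {Γ : C.Ctx} {x : Σ Γ, C.Ty Γ} (hx : x ∈ P.CT) (σ : Γ ⟶ x.1) :
    P.rTy (C.tySub σ x.2) = .app (.inl x) (P.rHom σ) := by
  rw [rTy_sub, rTy, P.raw_ty x hx]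
  change Raw.app _ _ = _
  congr 1
  funext i
  have := P.rHom_comp σ (𝟙 x.1) i
  rw [rHom_id, Category.comp_id] at this
  exact this.symm

theorem rTm_gen {Γ : C.Ctx} {x : Σ Γ, C.Tm Γ} (hx : x ∈ P.CM) (σ : Γ ⟶ x.1) :
    P.rTm (C.tmSub σ x.2) = .app (.inr x) (P.rHom σ) := by
  rw [rTm_sub, rTm, P.raw_tm x hx]
  change Raw.app _ _ = _
  congr 1
  funext i
  have := P.rHom_comp σ (𝟙 x.1) i
  rw [rHom_id, Category.comp_id] at this
  exact this.symm

/-- The variables of a context. -/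
def IsVar {Γ : C.Ctx} (a : C.Tm Γ) : Prop := (P.con Γ).IsVar a

theorem isVar_ext {Γ : C.Ctx} {A : C.Ty Γ} {a : C.Tm (C.ext A)} :
    P.IsVar a ↔ a = C.q A ∨ ∃ b, P.IsVar b ∧ a = C.tmSub (C.p A) b := by
  rw [IsVar, P.con_ext]; rfl

theorem not_isVar_empty (a : C.Tm C.empty) : ¬ P.IsVar a := by
  rw [IsVar, P.con_empty]; exact id

theorem IsVar.exists_rTm {P : Presentation C} {Γ : C.Ctx} {a : C.Tm Γ} (h : P.IsVar a) :
    ∃ i, i < P.len Γ ∧ P.rTm a = .var i := by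
  induction Γ using P.ctx_induction with
  | empty => exact (P.not_isVar_empty a h).elim
  | ext Γ A ih =>
    rw [P.len_ext]
    obtain rfl | ⟨b, hb, rfl⟩ := P.isVar_ext.1 h
    · exact ⟨_, Nat.lt_succ_self _, P.rTm_q A⟩
    · obtain ⟨i, hi, hb'⟩ := ih hb
      exact ⟨i, by omega, by rw [P.rTm_wk, hb']⟩

theorem IsVar.eq_of_rTm {P : Presentation C} {Γ : C.Ctx} {a b : C.Tm Γ} (ha : P.IsVar a)
    (hb : P.IsVar b) (h : P.rTm a = P.rTm b) : a = b := by
  induction Γ using P.ctx_induction with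
  | empty => exact (P.not_isVar_empty a ha).elim
  | ext Γ A ih =>
    rw [P.isVar_ext] at ha hb
    obtain rfl | ⟨a, ha, rfl⟩ := ha <;> obtain rfl | ⟨b, hb, rfl⟩ := hb
    · rfl
    · obtain ⟨i, hi, hb'⟩ := hb.exists_rTm
      rw [P.rTm_q, P.rTm_wk, hb'] at h
      cases h
      omega
    · obtain ⟨i, hi, ha'⟩ := ha.exists_rTm
      rw [P.rTm_q, P.rTm_wk, ha'] at h
      cases h
      omega
    · rw [P.rTm_wk, P.rTm_wk] at h
      rw [ih ha hb h]

theorem exists_var {Γ : C.Ctx} {i : ℕ} (hi : i < P.len Γ) :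
    ∃ a : C.Tm Γ, P.IsVar a ∧ P.rTm a = .var i := by
  induction Γ using P.ctx_induction with
  | empty => rw [P.len_empty] at hi; omega
  | ext Γ A ih =>
    rw [P.len_ext] at hi
    rcases Nat.lt_succ_iff_lt_or_eq.1 hi with hi | rfl
    · obtain ⟨a, ha, h⟩ := ih hi
      exact ⟨_, P.isVar_ext.2 (Or.inr ⟨a, ha, rfl⟩), by rw [P.rTm_wk, h]⟩
    · exact ⟨_, P.isVar_ext.2 (Or.inl rfl), P.rTm_q A⟩

theorem hom_ext_of_var {Δ Γ : C.Ctx} {σ τ : Δ ⟶ Γ}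
    (h : ∀ a, P.IsVar a → C.tmSub σ a = C.tmSub τ a) : σ = τ := by
  induction Γ using P.ctx_induction with
  | empty => exact C.emptyIsTerminal.hom_ext _ _
  | ext Γ A ih =>
    refine C.ext_hom_ext A _ _ (ih fun a ha => ?_) (h _ (P.isVar_ext.2 (Or.inl rfl)))
    rw [C.tmSub_comp, C.tmSub_comp]
    exact h _ (P.isVar_ext.2 (Or.inr ⟨a, ha, rfl⟩))

theorem rTm_sub_var {Δ Γ : C.Ctx} (σ : Δ ⟶ Γ) {a : C.Tm Γ} {i : ℕ} (h : P.rTm a = .var i) :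
    P.rTm (C.tmSub σ a) = P.rHom σ i := by
  rw [P.rTm_sub, h]; rfl

/-- This is the absence of equations. The head of the raw expression separates variables from
instances of symbols and determines the symbol; its arguments determine the substitution, variable
by variable. The induction runs over raw expressions, since the terms of C are not an inductive
type. -/
theorem rTm_injective {Γ : C.Ctx} {a b : C.Tm Γ} (h : P.rTm a = P.rTm b) : a = b := by
  obtain ⟨t, ht⟩ : ∃ t, P.rTm a = t := ⟨_, rfl⟩
  induction t generalizing Γ a b with
  | bot =>
    rcases P.gen_tm a with ha | ⟨x, hx, σ, rfl⟩
    · obtain ⟨i, -, hi⟩ := IsVar.exists_rTm ha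
      rw [ht] at hi; cases hi
    · rw [P.rTm_gen hx] at ht; cases ht
  | var i =>
    rcases P.gen_tm a with ha | ⟨x, hx, σ, rfl⟩
    · rcases P.gen_tm b with hb | ⟨x, hx, σ, rfl⟩
      · exact IsVar.eq_of_rTm ha hb h
      · rw [ht, P.rTm_gen hx] at h; cases h
    · rw [P.rTm_gen hx] at ht; cases ht
  | app s r ih =>
    rcases P.gen_tm a with ha | ⟨x, hx, σ, rfl⟩
    · obtain ⟨i, -, hi⟩ := IsVar.exists_rTm ha
      rw [ht] at hi; cases hi
    · rcases P.gen_tm b with hb | ⟨y, hy, τ, rfl⟩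
      · obtain ⟨i, -, hi⟩ := IsVar.exists_rTm hb
        rw [← h, ht] at hi; cases hi
      · rw [P.rTm_gen hx] at ht
        rw [P.rTm_gen hx, P.rTm_gen hy] at h
        injection ht with _ ht
        injection h with h1 h2
        injection h1 with h1
        subst h1
        congr 1
        refine P.hom_ext_of_var fun v hv => ?_
        obtain ⟨i, -, hi⟩ := IsVar.exists_rTm hv
        refine ih i ?_ ?_
        · rw [P.rTm_sub_var σ hi, P.rTm_sub_var τ hi, h2]
        · rw [P.rTm_sub_var σ hi, ht]

theorem rHom_injective {Δ Γ : C.Ctx} {σ τ : Δ ⟶ Γ} (h : ∀ i, i < P.len Γ → P.rHom σ i = P.rHom τ i) :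
    σ = τ := by
  refine P.hom_ext_of_var fun v hv => P.rTm_injective ?_
  obtain ⟨i, hi, hv⟩ := IsVar.exists_rTm hv
  rw [P.rTm_sub_var σ hv, P.rTm_sub_var τ hv, h i hi]

theorem rTy_injective {Γ : C.Ctx} {A B : C.Ty Γ} (h : P.rTy A = P.rTy B) : A = B := by
  obtain ⟨x, hx, σ, rfl⟩ := P.gen_ty A
  obtain ⟨y, hy, τ, rfl⟩ := P.gen_ty B
  rw [P.rTy_gen hx, P.rTy_gen hy] at h
  injection h with h1 h2
  injection h1 with h1
  subst h1
  rw [P.rHom_injective fun i _ => congrFun h2 i]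

end Presentation

/-! ### Pullbacks of telescopes -/

theorem lift_p (C : CwF.{u}) {Γ Δ : C.Ctx} (σ : Δ ⟶ Γ) (A : C.Ty Γ) :
    C.lift σ A ≫ C.p A = C.p (C.tySub σ A) ≫ σ := C.pair_p _ _ _ _

theorem lift_q (C : CwF.{u}) {Γ Δ : C.Ctx} (σ : Δ ⟶ Γ) (A : C.Ty Γ) :
    C.tmSub (C.lift σ A) (C.q A) = C.q (C.tySub σ A) := C.pair_q _ _ _ _

theorem isPullback_lift (C : CwF.{u}) {Γ Δ : C.Ctx} (σ : Δ ⟶ Γ) (A : C.Ty Γ) :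
    IsPullback (C.lift σ A) (C.p (C.tySub σ A)) (C.p A) σ := by
  have hq : ∀ s : PullbackCone (C.p A) σ,
      C.tp (C.tmSub s.fst (C.q A)) = C.tySub s.snd (C.tySub σ A) := fun s => by
    rw [C.tp_tmSub, C.tp_q, ← C.tySub_comp, ← C.tySub_comp, s.condition]
  refine ⟨⟨C.lift_p σ A⟩, ⟨PullbackCone.IsLimit.mk _
    (fun s => C.pair s.snd _ (C.tmSub s.fst (C.q A)) (hq s)) (fun s => ?_)
    (fun s => C.pair_p _ _ _ _) (fun s m h1 h2 => ?_)⟩⟩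
  · apply C.ext_hom_ext
    · rw [Category.assoc, C.lift_p, ← Category.assoc, C.pair_p, s.condition]
    · rw [C.tmSub_comp, C.lift_q, C.pair_q]
  · apply C.ext_hom_ext
    · rw [C.pair_p, h2]
    · rw [C.pair_q, ← h1, C.tmSub_comp, C.lift_q]

theorem Tele.isPullback_lift {C : CwF.{u}} {Γ Θ : C.Ctx} (ρ : Θ ⟶ Γ) (Δ : Tele C Γ) :
    IsPullback (Δ.lift ρ) (Δ.sub ρ).proj Δ.proj ρ := by
  induction Δ generalizing Θ with
  | nil =>
    have h : IsPullback ρ (𝟙 Θ) (𝟙 _) ρ := IsPullback.of_vert_isIso ⟨by simp⟩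
    exact h
  | cons A Δ ih => exact (ih (C.lift ρ A)).paste_vert (C.isPullback_lift ρ A)

end CwF

/-! ### Injectivity of renamings on raw expressions -/

namespace Raw

variable {S : Type u}

theorem subst_injective {n : ℕ} {r : ℕ → Raw S} (hvar : ∀ i < n, ∃ k, r i = var k)
    (hinj : ∀ i < n, ∀ j < n, r i = r j → i = j) {t t' : Raw S} (ht : t.Scoped n)
    (ht' : t'.Scoped n) (h : t.subst r = t'.subst r) : t = t' := by
  induction t generalizing t' with
  | bot =>
    cases t' with
    | bot => rfl
    | var j =>
      obtain ⟨k, hk⟩ := hvar j (ht' j rfl)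
      simp only [subst, hk] at h
      cases h
    | app s a => cases h
  | var i =>
    obtain ⟨l, hl⟩ := hvar i (ht i rfl)
    cases t' with
    | bot =>
      simp only [subst, hl] at h
      cases h
    | var j => rw [hinj i (ht i rfl) j (ht' j rfl) h]
    | app s a =>
      simp only [subst, hl] at h
      cases h
  | app s a ih =>
    cases t' with
    | bot => cases h
    | var j =>
      obtain ⟨k, hk⟩ := hvar j (ht' j rfl)
      simp only [subst, hk] at h
      cases h
    | app s' a' =>
      simp only [subst] at h
      injection h with h1 h2
      subst h1
      congr 1
      funext k
      exact ih k (fun i hi => ht i ⟨k, hi⟩) (fun i hi => ht' i ⟨k, hi⟩) (congrFun h2 k)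

end Raw

namespace CwF

namespace Presentation

variable {C : CwF.{u}} (P : Presentation C)

/-! ### Renamings and strengthening -/

/-- A substitution whose components are distinct variables. -/
def IsRenaming {Γ Q : C.Ctx} (π : Γ ⟶ Q) : Prop :=
  (∀ i < P.len Q, ∃ k, P.rHom π i = .var k) ∧
    ∀ i < P.len Q, ∀ j < P.len Q, P.rHom π i = P.rHom π j → i = j

theorem IsRenaming.tySub_injective {P : Presentation C} {Γ Q : C.Ctx} {π : Γ ⟶ Q}
    (h : P.IsRenaming π) {A B : C.Ty Q} (e : C.tySub π A = C.tySub π B) : A = B := by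
  refine P.rTy_injective (Raw.subst_injective h.1 h.2 (P.scoped_rTy A) (P.scoped_rTy B) ?_)
  rw [← P.rTy_sub, ← P.rTy_sub, e]

theorem IsRenaming.tmSub_injective {P : Presentation C} {Γ Q : C.Ctx} {π : Γ ⟶ Q}
    (h : P.IsRenaming π) {a b : C.Tm Q} (e : C.tmSub π a = C.tmSub π b) : a = b := by
  refine P.rTm_injective (Raw.subst_injective h.1 h.2 (P.scoped_rTm a) (P.scoped_rTm b) ?_)
  rw [← P.rTm_sub, ← P.rTm_sub, e]

theorem isRenaming_p {Γ : C.Ctx} (A : C.Ty Γ) : P.IsRenaming (C.p A) := by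
  rw [IsRenaming, P.rHom_p]
  refine ⟨fun i hi => ⟨i, Raw.idn_of_lt hi⟩, fun i hi j hj h => ?_⟩
  rw [Raw.idn_of_lt hi, Raw.idn_of_lt hj] at h
  exact Raw.var.inj h

theorem rHom_p_comp {Γ Q : C.Ctx} (B : C.Ty Γ) (σ : Γ ⟶ Q) (i : ℕ) :
    P.rHom (C.p B ≫ σ) i = P.rHom σ i := by
  rw [P.rHom_comp, P.rHom_p, Raw.subst_idn (P.scoped_rHom σ i)]

theorem IsRenaming.p_comp {P : Presentation C} {Γ Q : C.Ctx} {π : Γ ⟶ Q}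
    (h : P.IsRenaming π) (B : C.Ty Γ) : P.IsRenaming (C.p B ≫ π) := by
  simpa only [IsRenaming, P.rHom_p_comp] using h

theorem rHom_lift_lt {Γ Θ : C.Ctx} (ρ : Θ ⟶ Γ) (A : C.Ty Γ) {i : ℕ} (hi : i < P.len Γ) :
    P.rHom (C.lift ρ A) i = P.rHom ρ i := by
  rw [← P.rHom_comp_p _ hi, C.lift_p, P.rHom_p_comp]

theorem rHom_lift_len {Γ Θ : C.Ctx} (ρ : Θ ⟶ Γ) (A : C.Ty Γ) :
    P.rHom (C.lift ρ A) (P.len Γ) = .var (P.len Θ) := by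
  rw [← P.rTm_sub_q, C.lift_q, P.rTm_q]

theorem IsRenaming.lift {P : Presentation C} {Γ Q : C.Ctx} {π : Γ ⟶ Q}
    (h : P.IsRenaming π) (B : C.Ty Q) : P.IsRenaming (C.lift π B) := by
  have hne : ∀ i < P.len Q, P.rHom π i ≠ .var (P.len Γ) := fun i _ e => by
    have := P.scoped_rHom π i (P.len Γ) (by rw [e]; rfl)
    omega
  rw [IsRenaming, P.len_ext]
  constructor
  · intro i hi
    rcases Nat.lt_succ_iff_lt_or_eq.1 hi with hi | rfl
    · rw [P.rHom_lift_lt _ _ hi]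
      exact h.1 i hi
    · exact ⟨_, P.rHom_lift_len _ _⟩
  · intro i hi j hj e
    rcases Nat.lt_succ_iff_lt_or_eq.1 hi with hi | rfl <;>
      rcases Nat.lt_succ_iff_lt_or_eq.1 hj with hj | rfl
    · rw [P.rHom_lift_lt _ _ hi, P.rHom_lift_lt _ _ hj] at e
      exact h.2 i hi j hj e
    · rw [P.rHom_lift_lt _ _ hi, P.rHom_lift_len] at e
      exact (hne i hi e).elim
    · rw [P.rHom_lift_lt _ _ hj, P.rHom_lift_len] at e
      exact (hne j hj e.symm).elim
    · rfl

/-- Components are factored one at a time. The type of a component is an instance along the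
preceding ones, so its variables are good too, and injectivity of the renaming makes the factored
component well typed. -/
theorem factor_hom_of_tm {P : Presentation C} {Γ Q Z : C.Ctx} {π : Γ ⟶ Q} (hπ : P.IsRenaming π)
    (good : ℕ → Prop) (σ : Γ ⟶ Z) (hσ : ∀ i j, (P.rHom σ i).Occ j → good j)
    (htm : ∀ (i : ℕ) (a : C.Tm Γ), P.rTm a = P.rHom σ i →
      (∀ j, (P.rTy (C.tp a)).Occ j → good j) → ∃ b, a = C.tmSub π b) :
    ∃ τ : Q ⟶ Z, π ≫ τ = σ := by
  induction Z using P.ctx_induction with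
  | empty => exact ⟨C.emptyIsTerminal.from Q, C.emptyIsTerminal.hom_ext _ _⟩
  | ext Z A ih =>
    have hp : ∀ i, P.rHom (σ ≫ C.p A) i = P.rHom σ i ∨ P.rHom (σ ≫ C.p A) i = .bot := fun i => by
      by_cases hi : i < P.len Z
      · exact Or.inl (P.rHom_comp_p σ hi)
      · exact Or.inr (P.rHom_of_le _ (Nat.le_of_not_lt hi))
    have hgood : ∀ i j, (P.rHom (σ ≫ C.p A) i).Occ j → good j := fun i j h => by
      rcases hp i with e | e <;> rw [e] at h
      · exact hσ i j h
      · exact h.elim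
    obtain ⟨τ, hτ⟩ := ih (σ ≫ C.p A) hgood fun i a ha hj => by
      rcases hp i with e | e <;> rw [e] at ha
      · exact htm i a ha hj
      -- The dropped component reads as the padding `bot`, which `σ` also has at its first index out
      -- of range.
      · exact htm (P.len (C.ext A)) a (ha.trans (P.rHom_of_le σ le_rfl).symm) hj
    have htp : C.tp (C.tmSub σ (C.q A)) = C.tySub (σ ≫ C.p A) A := by
      rw [C.tp_tmSub, C.tp_q, C.tySub_comp]
    obtain ⟨b, hb⟩ := htm (P.len Z) (C.tmSub σ (C.q A)) (P.rTm_sub_q σ) fun j hj => by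
      rw [htp, P.rTy_sub] at hj
      obtain ⟨i, -, hi⟩ := Raw.occ_subst.1 hj
      exact hgood i j hi
    have hb' : C.tp b = C.tySub τ A := hπ.tySub_injective (by
      rw [← C.tp_tmSub, ← hb, htp, ← hτ, C.tySub_comp])
    refine ⟨C.pair τ A b hb', C.ext_hom_ext A _ _ ?_ ?_⟩
    · rw [Category.assoc, C.pair_p, hτ]
    · rw [C.tmSub_comp, C.pair_q, hb]

/-- A term factors through the renaming `π` if its variables and those of its type are good and the
good variables of good type factor. -/
theorem factor_tm {P : Presentation C} {Γ Q : C.Ctx} {π : Γ ⟶ Q} (hπ : P.IsRenaming π)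
    (good : ℕ → Prop)
    (hvar : ∀ v : C.Tm Γ, P.IsVar v → (∀ j, (P.rTm v).Occ j → good j) →
      (∀ j, (P.rTy (C.tp v)).Occ j → good j) → ∃ b, v = C.tmSub π b)
    (a : C.Tm Γ) (ha : ∀ j, (P.rTm a).Occ j → good j)
    (hA : ∀ j, (P.rTy (C.tp a)).Occ j → good j) : ∃ b, a = C.tmSub π b := by
  obtain ⟨t, ht⟩ : ∃ t, P.rTm a = t := ⟨_, rfl⟩
  induction t generalizing a with
  | bot =>
    rcases P.gen_tm a with h | ⟨x, hx, σ, rfl⟩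
    · exact hvar a h ha hA
    · rw [P.rTm_gen hx] at ht; cases ht
  | var i =>
    rcases P.gen_tm a with h | ⟨x, hx, σ, rfl⟩
    · exact hvar a h ha hA
    · rw [P.rTm_gen hx] at ht; cases ht
  | app s r ih =>
    rcases P.gen_tm a with h | ⟨x, hx, σ, rfl⟩
    · exact hvar a h ha hA
    · rw [P.rTm_gen hx] at ht ha
      have hr : P.rHom σ = r := (Raw.app.inj ht).2
      obtain ⟨τ, rfl⟩ := factor_hom_of_tm hπ good σ (fun i j hj => ha j ⟨i, hj⟩)
        fun i b hb hB => ih i b (fun j hj => ha j ⟨i, by rwa [← hb]⟩) hB (by rw [hb, hr])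
      exact ⟨C.tmSub τ x.2, C.tmSub_comp _ _ _⟩

theorem factor_ty {P : Presentation C} {Γ Q : C.Ctx} {π : Γ ⟶ Q} (hπ : P.IsRenaming π)
    (good : ℕ → Prop)
    (hvar : ∀ v : C.Tm Γ, P.IsVar v → (∀ j, (P.rTm v).Occ j → good j) →
      (∀ j, (P.rTy (C.tp v)).Occ j → good j) → ∃ b, v = C.tmSub π b)
    (A : C.Ty Γ) (hA : ∀ j, (P.rTy A).Occ j → good j) : ∃ B, A = C.tySub π B := by
  obtain ⟨x, hx, σ, rfl⟩ := P.gen_ty A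
  rw [P.rTy_gen hx] at hA
  obtain ⟨τ, rfl⟩ := factor_hom_of_tm hπ good σ (fun i j hj => hA j ⟨i, hj⟩)
    fun i b hb hB => factor_tm hπ good hvar b (fun j hj => hA j ⟨i, by rwa [← hb]⟩) hB
  exact ⟨C.tySub τ x.2, C.tySub_comp _ _ _⟩

/-- The type of a variable only mentions earlier variables; in particular it does not mention the
variable itself. -/
theorem scoped_tp_var {Γ : C.Ctx} {x : C.Tm Γ} {i : ℕ} (hx : P.IsVar x) (hi : P.rTm x = .var i) :
    (P.rTy (C.tp x)).Scoped i := by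
  induction Γ using P.ctx_induction with
  | empty => exact (P.not_isVar_empty x hx).elim
  | ext Γ A ih =>
    obtain rfl | ⟨b, hb, rfl⟩ := P.isVar_ext.1 hx
    · rw [P.rTm_q] at hi
      cases hi
      rw [C.tp_q, P.rTy_wk]
      exact P.scoped_rTy A
    · rw [P.rTm_wk] at hi
      rw [C.tp_tmSub, P.rTy_wk]
      exact ih hb hi

/-! ### Carrable morphisms -/

/-- All pullbacks of `d` exist and extend the length of the base by `k`. -/
def Carrable (k : ℕ) {Γ Q : C.Ctx} (d : Γ ⟶ Q) : Prop :=
  ∀ (Θ : C.Ctx) (s : Θ ⟶ Q), ∃ (Θ' : C.Ctx) (t : Θ' ⟶ Γ) (d' : Θ' ⟶ Θ),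
    IsPullback t d' d s ∧ P.len Θ' = P.len Θ + k

theorem carrable_id (Γ : C.Ctx) : P.Carrable 0 (𝟙 Γ) := fun Θ s =>
  ⟨Θ, s, 𝟙 Θ, IsPullback.of_vert_isIso ⟨by simp⟩, rfl⟩

theorem Carrable.p_comp {P : Presentation C} {k : ℕ} {Γ Q : C.Ctx} {d : Γ ⟶ Q}
    (h : P.Carrable k d) (B : C.Ty Γ) : P.Carrable (k + 1) (C.p B ≫ d) := fun Θ s => by
  obtain ⟨Θ', t, d', hpb, hlen⟩ := h Θ s
  exact ⟨_, _, _, (C.isPullback_lift t B).paste_vert hpb, by rw [P.len_ext, hlen, Nat.add_assoc]⟩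

theorem Carrable.of_isPullback {P : Presentation C} {k : ℕ} {Γ Q Γ' Q' : C.Ctx} {d : Γ ⟶ Q}
    {d' : Γ' ⟶ Q'} {f : Γ' ⟶ Γ} {f' : Q' ⟶ Q} (h : P.Carrable k d)
    (hpb : IsPullback f d' d f') : P.Carrable k d' := fun Θ s => by
  obtain ⟨Θ', t, e, hpb', hlen⟩ := h Θ (s ≫ f')
  refine ⟨Θ', hpb.lift t (e ≫ s) (by rw [hpb'.w, Category.assoc]), e,
    IsPullback.of_right ?_ (hpb.lift_snd _ _ _) hpb, hlen⟩
  rwa [hpb.lift_fst]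

/-! ### Substitution of a term for a variable -/

/-- A context can be rearranged so that a variable `i` only comes after all the variables whose
types do not depend on it: `d` is a projection to `Q.A` that sends the last variable to `i`. -/
theorem exists_split {Γ : C.Ctx} {i : ℕ} (hi : i < P.len Γ) :
    ∃ (Q : C.Ctx) (A : C.Ty Q) (k : ℕ) (d : Γ ⟶ C.ext A), P.Carrable k d ∧
      P.len Γ = P.len Q + 1 + k ∧ P.rHom d (P.len Q) = .var i ∧ P.IsRenaming (d ≫ C.p A) ∧
      ∀ v : C.Tm Γ, P.IsVar v → (∀ j, (P.rTm v).Occ j → j ≠ i) →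
        (∀ j, (P.rTy (C.tp v)).Occ j → j ≠ i) → ∃ b, v = C.tmSub (d ≫ C.p A) b := by
  induction Γ using P.ctx_induction with
  | empty => rw [P.len_empty] at hi; omega
  | ext Γ B ih =>
    rw [P.len_ext] at hi
    rcases Nat.lt_succ_iff_lt_or_eq.1 hi with hi | rfl
    · obtain ⟨Q, A, k, d, hd, hlen, hdi, hren, hvar⟩ := ih hi
      -- If `B` does not mention `i`, it comes from `Q` and its variable moves in front of `i`; the
      -- new projection is a pullback of `d`, hence still carrable. Otherwise its variable stays
      -- behind `i` and `k` grows. Indirect dependency is covered too, since a symbol lists the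
      -- whole substitution as its arguments.
      by_cases hB : ∀ j, (P.rTy B).Occ j → j ≠ i
      · obtain ⟨B, rfl⟩ := factor_ty hren _ hvar B hB
        have right := (C.isPullback_lift (C.p B) A).flip
        have outer := C.isPullback_lift (d ≫ C.p A) B
        obtain ⟨d', h1, h2⟩ : ∃ d', d' ≫ C.p (C.tySub (C.p B) A) = C.lift (d ≫ C.p A) B ∧
            d' ≫ C.lift (C.p B) A = C.p (C.tySub (d ≫ C.p A) B) ≫ d :=
          ⟨right.lift _ _ (by rw [outer.w, Category.assoc]), right.lift_fst _ _ _,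
            right.lift_snd _ _ _⟩
        have left : IsPullback d' (C.p (C.tySub (d ≫ C.p A) B)) (C.lift (C.p B) A) d :=
          IsPullback.of_right (by rwa [h1]) h2 right
        refine ⟨C.ext B, C.tySub (C.p B) A, k, d', hd.of_isPullback left.flip, ?_, ?_, ?_, ?_⟩
        · rw [P.len_ext, P.len_ext, hlen]; omega
        · rw [← P.rTm_sub_q, ← C.lift_q, ← C.tmSub_comp, h2, P.rTm_sub_q, P.rHom_p_comp, hdi]
        · rw [h1]
          exact hren.lift B
        · intro v hv hv1 hv2
          rw [h1]
          obtain rfl | ⟨b, hb, rfl⟩ := P.isVar_ext.1 hv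
          · exact ⟨C.q B, (C.lift_q _ _).symm⟩
          · rw [P.rTm_wk] at hv1
            rw [C.tp_tmSub, P.rTy_wk] at hv2
            obtain ⟨c, rfl⟩ := hvar b hb hv1 hv2
            exact ⟨C.tmSub (C.p B) c, by rw [← C.tmSub_comp, ← C.tmSub_comp, C.lift_p]⟩
      · refine ⟨Q, A, k + 1, C.p B ≫ d, hd.p_comp B, ?_, ?_, ?_, ?_⟩
        · rw [P.len_ext, hlen]; omega
        · rw [P.rHom_p_comp, hdi]
        · rw [Category.assoc]
          exact hren.p_comp B
        · intro v hv hv1 hv2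
          obtain rfl | ⟨b, hb, rfl⟩ := P.isVar_ext.1 hv
          · rw [C.tp_q, P.rTy_wk] at hv2
            exact (hB hv2).elim
          · rw [P.rTm_wk] at hv1
            rw [C.tp_tmSub, P.rTy_wk] at hv2
            obtain ⟨c, rfl⟩ := hvar b hb hv1 hv2
            exact ⟨c, by rw [← C.tmSub_comp, Category.assoc]⟩
    · refine ⟨Γ, B, 0, 𝟙 _, P.carrable_id _, by rw [P.len_ext], ?_, ?_, ?_⟩
      · rw [← P.rTm_sub_q, C.tmSub_id, P.rTm_q]
      · rw [Category.id_comp]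
        exact P.isRenaming_p B
      · intro v hv hv1 _
        obtain rfl | ⟨b, hb, rfl⟩ := P.isVar_ext.1 hv
        · rw [P.rTm_q] at hv1
          exact (hv1 _ rfl rfl).elim
        · exact ⟨b, by rw [Category.id_comp]⟩

/-- The most general substitution that identifies a variable with a term in which it does not
occur. -/
theorem exists_mgu_var {Γ : C.Ctx} {x t : C.Tm Γ} {i : ℕ} (hx : P.IsVar x)
    (hi : P.rTm x = .var i) (htp : C.tp t = C.tp x) (hocc : ¬ (P.rTm t).Occ i) :
    ∃ (Ω : C.Ctx) (ρ : Ω ⟶ Γ), C.tmSub ρ x = C.tmSub ρ t ∧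
      (∀ (Θ : C.Ctx) (σ : Θ ⟶ Γ), C.tmSub σ x = C.tmSub σ t → ∃! τ : Θ ⟶ Ω, τ ≫ ρ = σ) ∧
      P.len Ω < P.len Γ := by
  have hil : i < P.len Γ := P.scoped_rTm x i (by rw [hi]; rfl)
  obtain ⟨Q, A, k, d, hd, hlen, hdi, hren, hvar⟩ := P.exists_split hil
  have hxd : x = C.tmSub d (C.q A) := P.rTm_injective (by rw [hi, P.rTm_sub_q, hdi])
  obtain ⟨b, hb⟩ := factor_tm hren _ hvar t (by rintro j hj rfl; exact hocc hj) (by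
    rintro j hj rfl
    rw [htp] at hj
    exact lt_irrefl _ (P.scoped_tp_var hx hi _ hj))
  have hbA : C.tp b = C.tySub (𝟙 Q) A := by
    rw [C.tySub_id]
    refine hren.tySub_injective ?_
    rw [← C.tp_tmSub, ← hb, htp, hxd, C.tp_tmSub, C.tp_q, C.tySub_comp]
  have hsp := C.pair_p (𝟙 Q) A b hbA
  have hsq := C.pair_q (𝟙 Q) A b hbA
  generalize C.pair (𝟙 Q) A b hbA = s at hsp hsq
  -- The section `s` of `C.p A` puts `b` in place of the variable `i`. Pulling `d` back along it
  -- keeps the `k` later variables, so only `i` is lost.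
  obtain ⟨Ω, ρ, e, hpb, hΩ⟩ := hd Q s
  refine ⟨Ω, ρ, ?_, fun Θ σ hσ => ?_, by omega⟩
  · rw [hxd, hb, ← C.tmSub_comp, ← C.tmSub_comp, ← Category.assoc, hpb.w, C.tmSub_comp, hsq,
      Category.assoc, hsp, Category.comp_id]
  -- Unifying `x` with `t` means that `σ ≫ d` factors through `s`, which is what the pullback
  -- classifies.
  · have hσd : σ ≫ d = (σ ≫ d ≫ C.p A) ≫ s := by
      apply C.ext_hom_ext
      · simp only [Category.assoc, hsp, Category.comp_id]
      · rw [C.tmSub_comp σ d, ← hxd, hσ, hb, C.tmSub_comp (σ ≫ d ≫ C.p A), hsq, ← C.tmSub_comp]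
    refine ⟨hpb.lift _ _ hσd, hpb.lift_fst _ _ _, fun τ hτ => ?_⟩
    apply hpb.hom_ext
    · rw [hpb.lift_fst, hτ]
    · have h : e = ρ ≫ d ≫ C.p A := by
        rw [← Category.assoc, hpb.w, Category.assoc, hsp, Category.comp_id]
      rw [hpb.lift_snd, h, ← Category.assoc, hτ]

end Presentation

end CwF

/-! ### Proper subexpressions and the occurs check -/

namespace Raw

variable {S : Type u}

/-- Proper subexpressions. -/
def ProperSub (s : Raw S) : Raw S → Prop
  | bot => False
  | var _ => False
  | app _ a => ∃ k, a k = s ∨ ProperSub s (a k)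

theorem ProperSub.trans {s t v : Raw S} (h : ProperSub s t) (h' : ProperSub t v) :
    ProperSub s v := by
  induction v with
  | bot => exact h'.elim
  | var i => exact h'.elim
  | app f a ih =>
    obtain ⟨k, rfl | h'⟩ := h'
    · exact ⟨k, Or.inr h⟩
    · exact ⟨k, Or.inr (ih k h')⟩

theorem ProperSub.irrefl (s : Raw S) : ¬ ProperSub s s := by
  induction s with
  | bot => exact id
  | var i => exact id
  | app f a ih =>
    rintro ⟨k, h⟩
    have hk : ProperSub (a k) (app f a) := ⟨k, Or.inl rfl⟩
    rcases h with h | h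
    · exact ih k (h.symm ▸ hk)
    · exact ih k (hk.trans h)

theorem properSub_subst {r : ℕ → Raw S} {i : ℕ} {t : Raw S} (h : t.Occ i) (ht : t ≠ var i) :
    ProperSub (r i) (t.subst r) := by
  induction t with
  | bot => exact h.elim
  | var j => exact (ht (congrArg var (Eq.symm h))).elim
  | app f a ih =>
    obtain ⟨k, hk⟩ := h
    by_cases hv : a k = var i
    · exact ⟨k, Or.inl (congrArg (subst r) hv)⟩
    · exact ⟨k, Or.inr (ih k hk hv)⟩

end Raw

namespace CwF

namespace Presentation

variable {C : CwF.{u}} (P : Presentation C)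

/-! ### Raw expressions and telescopes -/

theorem len_tele {Γ : C.Ctx} (Δ : Tele C Γ) : P.len Δ.ext = P.len Γ + Δ.length := by
  induction Δ with
  | nil => rfl
  | cons A Δ ih =>
    rw [P.len_ext] at ih
    simp only [Tele.ext, Tele.length, ih]
    omega

theorem rHom_proj {Γ : C.Ctx} (Δ : Tele C Γ) {i : ℕ} (hi : i < P.len Γ) :
    P.rHom Δ.proj i = .var i := by
  induction Δ with
  | nil => exact (congrFun (P.rHom_id _) i).trans (Raw.idn_of_lt hi)
  | cons A Δ ih =>
    rw [Tele.proj]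
    exact (P.rHom_comp_p Δ.proj hi).trans (ih (by rw [P.len_ext]; omega))

theorem isRenaming_proj {Γ : C.Ctx} (Δ : Tele C Γ) : P.IsRenaming Δ.proj :=
  ⟨fun i hi => ⟨i, P.rHom_proj Δ hi⟩, fun i hi j hj h => by
    rw [P.rHom_proj Δ hi, P.rHom_proj Δ hj] at h
    exact Raw.var.inj h⟩

theorem rHom_teleLift_lt {Γ Θ : C.Ctx} (Δ : Tele C Γ) (ρ : Θ ⟶ Γ) {i : ℕ} (hi : i < P.len Γ) :
    P.rHom (Δ.lift ρ) i = P.rHom ρ i := by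
  induction Δ generalizing Θ with
  | nil => rfl
  | cons A Δ ih => exact (ih _ (by rw [P.len_ext]; omega)).trans (P.rHom_lift_lt ρ A hi)

/-- Rigid variables are never instantiated: they are only renumbered, because levels are counted
from the start of the context. -/
theorem rHom_teleLift_add {Γ Θ : C.Ctx} (Δ : Tele C Γ) (ρ : Θ ⟶ Γ) {k : ℕ} (hk : k < Δ.length) :
    P.rHom (Δ.lift ρ) (P.len Γ + k) = .var (P.len Θ + k) := by
  induction Δ generalizing Θ k with
  | nil => exact (Nat.not_lt_zero k hk).elim
  | @cons Γ A Δ ih =>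
    cases k with
    | zero =>
      exact (P.rHom_teleLift_lt Δ (C.lift ρ A) (by rw [P.len_ext]; omega)).trans
        (P.rHom_lift_len ρ A)
    | succ k =>
      have := ih (C.lift ρ A) (Nat.lt_of_succ_lt_succ hk)
      rw [P.len_ext, P.len_ext] at this
      rw [Nat.add_comm k 1, ← Nat.add_assoc, ← Nat.add_assoc]
      exact this

theorem exists_tele (P : Presentation C) (Γ : C.Ctx) : ∃ T : Tele C C.empty, T.ext = Γ := by
  -- Telescopes grow at the front and contexts at the end.
  have snoc : ∀ {Γ : C.Ctx} (T : Tele C Γ) (A : C.Ty T.ext), ∃ T' : Tele C Γ, T'.ext = C.ext A := by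
    intro Γ T
    induction T with
    | nil => exact fun A => ⟨.cons A .nil, rfl⟩
    | cons B T ih =>
      intro A
      obtain ⟨T', h⟩ := ih A
      exact ⟨.cons B T', h⟩
  induction Γ using P.ctx_induction with
  | empty => exact ⟨.nil, rfl⟩
  | ext Γ A ih =>
    obtain ⟨T, rfl⟩ := ih
    exact snoc T A

theorem hasLength (Γ : C.Ctx) : C.HasLength Γ (P.len Γ) := by
  refine ⟨P.exists_tele Γ, ?_⟩
  rintro T rfl
  rw [P.len_tele, P.len_empty, Nat.zero_add]

end Presentation

/-! ### Unification problems -/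

/-- The sieve of morphisms that equalize two substitutions. -/
def eqHom {C : CwF.{u}} {Q Z : C.Ctx} (f g : Q ⟶ Z) : Sieve Q where
  arrows _ w := w ≫ f = w ≫ g
  downward_closed {_ _} w h v := by rw [Category.assoc, Category.assoc, h]

/-- The sieve of morphisms that equalize two terms. -/
def eqTm {C : CwF.{u}} {Q : C.Ctx} (a b : C.Tm Q) : Sieve Q where
  arrows _ w := C.tmSub w a = C.tmSub w b
  downward_closed {_ _} w h v := by rw [C.tmSub_comp, C.tmSub_comp, h]

theorem eqTm_symm {C : CwF.{u}} {Q : C.Ctx} (a b : C.Tm Q) : eqTm a b = eqTm b a :=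
  Sieve.ext fun _ _ => eq_comm

theorem eqHom_pullback {C : CwF.{u}} {Q Q' Z : C.Ctx} (f g : Q ⟶ Z) (w : Q' ⟶ Q) :
    (eqHom f g).pullback w = eqHom (w ≫ f) (w ≫ g) :=
  Sieve.ext fun _ v => by
    change (v ≫ w) ≫ f = (v ≫ w) ≫ g ↔ v ≫ w ≫ f = v ≫ w ≫ g
    rw [Category.assoc, Category.assoc]

/-- Some substitution of the flexible variables solves the problem `E`. -/
def Unifiable {C : CwF.{u}} {Γ : C.Ctx} (Δ : Tele C Γ) (E : Sieve Δ.ext) : Prop :=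
  ∃ (Θ : C.Ctx) (σ : Θ ⟶ Γ), E (Δ.lift σ)

/-- Substituting a telescope in one step or in two gives contexts that are compared here only as
pullbacks of the same projection. A sieve does not distinguish between them, which avoids transports
along equalities of telescopes. -/
theorem sieve_of_isPullback {C : CwF.{u}} {Γ Θ Q Y Y' : C.Ctx} (E : Sieve Q) {d : Q ⟶ Γ}
    {ρ : Θ ⟶ Γ} {w : Y ⟶ Q} {v : Y ⟶ Θ} {w' : Y' ⟶ Q} {v' : Y' ⟶ Θ} (h : IsPullback w v d ρ)
    (h' : IsPullback w' v' d ρ) (hE : E w) : E w' := by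
  rw [← h.lift_fst w' v' h'.w]
  exact E.downward_closed hE _

theorem sieve_lift_comp {C : CwF.{u}} {Γ Ω Θ : C.Ctx} (Δ : Tele C Γ) (E : Sieve Δ.ext)
    (ρ : Ω ⟶ Γ) (τ : Θ ⟶ Ω) :
    E (Δ.lift (τ ≫ ρ)) ↔ E.pullback (Δ.lift ρ) ((Δ.sub ρ).lift τ) :=
  have h := Δ.isPullback_lift (τ ≫ ρ)
  have h' := ((Δ.sub ρ).isPullback_lift τ).paste_horiz (Δ.isPullback_lift ρ)
  ⟨sieve_of_isPullback E h h', sieve_of_isPullback E h' h⟩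

namespace Presentation

variable {C : CwF.{u}} (P : Presentation C)

/-- The problem `E` has a most general solution with fewer flexible variables. -/
def HasMGU {Γ : C.Ctx} (Δ : Tele C Γ) (E : Sieve Δ.ext) : Prop :=
  ∃ (Ω : C.Ctx) (ρ : Ω ⟶ Γ), E (Δ.lift ρ) ∧
    (∀ (Θ : C.Ctx) (σ : Θ ⟶ Γ), E (Δ.lift σ) → ∃! τ : Θ ⟶ Ω, τ ≫ ρ = σ) ∧ P.len Ω < P.len Γ

/-- A most general unifier can be found in two stages. -/
theorem HasMGU.of_comp {P : Presentation C} {Γ Ω : C.Ctx} {Δ : Tele C Γ} {E : Sieve Δ.ext}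
    {ρ : Ω ⟶ Γ} (hlen : P.len Ω < P.len Γ)
    (huniv : ∀ (Θ : C.Ctx) (σ : Θ ⟶ Γ), E (Δ.lift σ) → ∃! τ : Θ ⟶ Ω, τ ≫ ρ = σ)
    (h : P.HasMGU (Δ.sub ρ) (E.pullback (Δ.lift ρ))) : P.HasMGU Δ E := by
  obtain ⟨Ω', ρ', h1, h2, h3⟩ := h
  refine ⟨Ω', ρ' ≫ ρ, (sieve_lift_comp Δ E ρ ρ').2 h1, fun Θ σ hσ => ?_, h3.trans hlen⟩
  obtain ⟨τ, rfl, hτ⟩ := huniv Θ σ hσ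
  obtain ⟨τ', rfl, hτ'⟩ := h2 Θ τ ((sieve_lift_comp Δ E ρ τ).1 hσ)
  refine ⟨τ', (Category.assoc _ _ _).symm, fun κ hκ => hτ' κ (hτ _ ?_)⟩
  change (κ ≫ ρ') ≫ ρ = _
  rw [Category.assoc]
  exact hκ

/-- Unification of substitutions, given the unification of their components and the unification of
substitutions with fewer flexible variables. -/
theorem hasMGU_hom_of_tm {P : Presentation C} {Γ : C.Ctx} (Δ : Tele C Γ)
    (hlt : ∀ {Γ' : C.Ctx} (Δ' : Tele C Γ') {Z : C.Ctx} (f g : Δ'.ext ⟶ Z), P.len Γ' < P.len Γ →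
      f ≠ g → Unifiable Δ' (eqHom f g) → P.HasMGU Δ' (eqHom f g))
    {Z : C.Ctx} (f g : Δ.ext ⟶ Z)
    (htm : ∀ (i : ℕ) (a b : C.Tm Δ.ext), P.rTm a = P.rHom f i → C.tp a = C.tp b → a ≠ b →
      Unifiable Δ (eqTm a b) → P.HasMGU Δ (eqTm a b))
    (hfg : f ≠ g) (hu : Unifiable Δ (eqHom f g)) : P.HasMGU Δ (eqHom f g) := by
  induction Z using P.ctx_induction with
  | empty => exact (hfg (C.emptyIsTerminal.hom_ext _ _)).elim
  | ext Z A ih =>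
    -- If the initial parts agree, the last components have the same type and only they remain to be
    -- unified.
    by_cases hp : f ≫ C.p A = g ≫ C.p A
    · have e : eqHom f g = eqTm (C.tmSub f (C.q A)) (C.tmSub g (C.q A)) := Sieve.ext fun Y w => by
        change w ≫ f = w ≫ g ↔ C.tmSub w _ = C.tmSub w _
        rw [← C.tmSub_comp, ← C.tmSub_comp]
        refine ⟨fun h => by rw [h], fun h => C.ext_hom_ext A _ _ ?_ h⟩
        rw [Category.assoc, Category.assoc, hp]
      rw [e] at hu ⊢
      refine htm (P.len Z) _ _ (P.rTm_sub_q f) ?_ (fun h => hfg (C.ext_hom_ext A _ _ hp h)) hu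
      rw [C.tp_tmSub, C.tp_tmSub, C.tp_q, ← C.tySub_comp, ← C.tySub_comp, hp]
    · have hle : ∀ {Y : C.Ctx} (w : Y ⟶ Δ.ext), eqHom f g w →
          eqHom (f ≫ C.p A) (g ≫ C.p A) w := fun w hw => by
        change w ≫ f ≫ _ = w ≫ g ≫ _
        have hw : w ≫ f = w ≫ g := hw
        rw [← Category.assoc, hw, Category.assoc]
      obtain ⟨Θ, σ, hσ⟩ := hu
      obtain ⟨Ω, ρ, -, huniv, hlen⟩ := ih (f ≫ C.p A) (g ≫ C.p A) (fun i a b ha => by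
        by_cases hi : i < P.len Z
        · exact htm i a b (by rw [ha, P.rHom_comp_p f hi])
        -- Both indices are out of range, so both components are the padding `bot`.
        · refine htm (P.len (C.ext A)) a b ?_
          rw [ha, P.rHom_of_le _ (Nat.le_of_not_lt hi), P.rHom_of_le _ le_rfl]) hp
        ⟨Θ, σ, hle _ hσ⟩
      by_cases he : Δ.lift ρ ≫ f = Δ.lift ρ ≫ g
      · exact ⟨Ω, ρ, he, fun Θ σ hσ => huniv Θ σ (hle _ hσ), hlen⟩
      -- Unifying the initial parts has used up a flexible variable, so the whole instantiated pair
      -- may be handed to `hlt`.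
      · refine HasMGU.of_comp hlen (fun Θ σ hσ => huniv Θ σ (hle _ hσ)) ?_
        obtain ⟨τ, rfl, -⟩ := huniv Θ σ (hle _ hσ)
        rw [sieve_lift_comp, eqHom_pullback] at hσ
        rw [eqHom_pullback]
        exact hlt _ _ _ hlen he ⟨Θ, τ, hσ⟩

/-- Unification of a variable and a term. -/
theorem hasMGU_var {Γ : C.Ctx} (Δ : Tele C Γ) {x t : C.Tm Δ.ext} (hx : P.IsVar x)
    (htp : C.tp x = C.tp t) (hne : x ≠ t) (hu : Unifiable Δ (eqTm x t)) :
    P.HasMGU Δ (eqTm x t) := by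
  obtain ⟨Θ, σ, hσ⟩ := hu
  have hσ : C.tmSub (Δ.lift σ) x = C.tmSub (Δ.lift σ) t := hσ
  obtain ⟨i, hi, hxi⟩ := hx.exists_rTm
  rw [P.len_tele] at hi
  have hrσ : P.rHom (Δ.lift σ) i = P.rTm (C.tmSub (Δ.lift σ) t) := by
    rw [← hσ, P.rTm_sub_var _ hxi]
  by_cases hiΓ : i < P.len Γ
  · have strengthen : ∀ (v : C.Tm Δ.ext) (j : ℕ), P.rTm v = .var j → j < P.len Γ →
        ∃ b, P.IsVar b ∧ P.rTm b = .var j ∧ v = C.tmSub Δ.proj b := fun v j hv hj => by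
      obtain ⟨b, hb, hb'⟩ := P.exists_var hj
      exact ⟨b, hb, hb', P.rTm_injective (by rw [hv, P.rTm_sub_var _ hb', P.rHom_proj _ hj])⟩
    obtain ⟨x, hx', hxi', rfl⟩ := strengthen x i hxi hiΓ
    -- A rigid variable in `t` would survive in `t[σ⁺] = x[σ⁺]`, which is a component of `σ` and
    -- only uses variables of `Θ`. Hence `t` already lives over `Γ`.
    obtain ⟨t, rfl⟩ := factor_tm (P.isRenaming_proj Δ) (· < P.len Γ)
      (fun v hv hv' _ => by
        obtain ⟨j, -, hj⟩ := hv.exists_rTm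
        obtain ⟨b, -, -, hb⟩ := strengthen v j hj (hv' j (by rw [hj]; rfl))
        exact ⟨b, hb⟩) t
      (fun j hj => by
        by_contra hjΓ
        obtain ⟨k, rfl⟩ := Nat.exists_eq_add_of_le (Nat.le_of_not_lt hjΓ)
        have hk := P.scoped_rTm t _ hj
        rw [P.len_tele] at hk
        have hocc : (P.rHom (Δ.lift σ) i).Occ (P.len Θ + k) := by
          rw [hrσ, P.rTm_sub]
          exact Raw.occ_subst.2 ⟨_, hj, by
            rw [P.rHom_teleLift_add Δ σ (Nat.lt_of_add_lt_add_left hk)]; rfl⟩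
        rw [P.rHom_teleLift_lt Δ σ hiΓ] at hocc
        have := P.scoped_rHom σ i _ hocc
        omega)
      (fun j hj => by
        rw [← htp, C.tp_tmSub, P.rTy_sub] at hj
        obtain ⟨l, hl, hl'⟩ := Raw.occ_subst.1 hj
        have hl := P.scoped_rTy _ _ hl
        rw [P.rHom_proj Δ hl] at hl'
        obtain rfl : j = l := hl'
        exact hl)
    have key : ∀ {Θ : C.Ctx} (ρ : Θ ⟶ Γ), eqTm (C.tmSub Δ.proj x) (C.tmSub Δ.proj t) (Δ.lift ρ) ↔
        C.tmSub ρ x = C.tmSub ρ t := fun ρ => by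
      change C.tmSub _ _ = C.tmSub _ _ ↔ _
      rw [← C.tmSub_comp, ← C.tmSub_comp, (Δ.isPullback_lift ρ).w, C.tmSub_comp, C.tmSub_comp]
      exact ⟨fun h => (P.isRenaming_proj _).tmSub_injective h, fun h => by rw [h]⟩
    have htp' : C.tp t = C.tp x := (P.isRenaming_proj Δ).tySub_injective (by
      rw [← C.tp_tmSub, ← C.tp_tmSub, htp])
    have hσ' := (key σ).1 hσ
    -- Occurs check: otherwise `x[σ]` would be a proper subexpression of `t[σ] = x[σ]`.
    have hocc : ¬ (P.rTm t).Occ i := fun h => by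
      have hv : P.rTm t ≠ .var i := fun e =>
        hne (by rw [P.rTm_injective (e.trans hxi'.symm)])
      have := Raw.properSub_subst (r := P.rHom σ) h hv
      rw [← P.rTm_sub, ← hσ', P.rTm_sub_var σ hxi'] at this
      exact Raw.ProperSub.irrefl _ this
    obtain ⟨Ω, ρ, h1, h2, h3⟩ := P.exists_mgu_var hx' hxi' htp' hocc
    exact ⟨Ω, ρ, (key ρ).2 h1, fun Θ τ hτ => h2 Θ τ ((key τ).1 hτ), h3⟩
  -- For rigid `x`, the instance of `t` is a rigid variable. A flexible variable or an instance of a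
  -- symbol cannot become that one, and a rigid variable does so only if it is `x`.
  · exfalso
    obtain ⟨k, rfl⟩ := Nat.exists_eq_add_of_le (Nat.le_of_not_lt hiΓ)
    rw [P.rHom_teleLift_add Δ σ (Nat.lt_of_add_lt_add_left hi)] at hrσ
    rcases P.gen_tm t with ht | ⟨y, hy, τ, rfl⟩
    · obtain ⟨j, hj, htj⟩ := IsVar.exists_rTm ht
      rw [P.rTm_sub_var _ htj] at hrσ
      by_cases hjΓ : j < P.len Γ
      · rw [P.rHom_teleLift_lt Δ σ hjΓ] at hrσ
        have := P.scoped_rHom σ j (P.len Θ + k) (by rw [← hrσ]; rfl)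
        omega
      · obtain ⟨l, rfl⟩ := Nat.exists_eq_add_of_le (Nat.le_of_not_lt hjΓ)
        rw [P.len_tele] at hj
        rw [P.rHom_teleLift_add Δ σ (Nat.lt_of_add_lt_add_left hj)] at hrσ
        have hkl : k = l := by
          have := Raw.var.inj hrσ
          omega
        exact hne (P.rTm_injective (by rw [hxi, htj, hkl]))
    · rw [← C.tmSub_comp, P.rTm_gen hy] at hrσ
      cases hrσ

/-- Unification of terms, given the unification of substitutions with fewer flexible variables. -/
theorem hasMGU_tm_of_hom {P : Presentation C} {Γ : C.Ctx} (Δ : Tele C Γ)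
    (hlt : ∀ {Γ' : C.Ctx} (Δ' : Tele C Γ') {Z : C.Ctx} (f g : Δ'.ext ⟶ Z), P.len Γ' < P.len Γ →
      f ≠ g → Unifiable Δ' (eqHom f g) → P.HasMGU Δ' (eqHom f g))
    (a b : C.Tm Δ.ext) (htp : C.tp a = C.tp b) (hne : a ≠ b) (hu : Unifiable Δ (eqTm a b)) :
    P.HasMGU Δ (eqTm a b) := by
  obtain ⟨t, ht⟩ : ∃ t, P.rTm a = t := ⟨_, rfl⟩
  induction t generalizing a b with
  | bot =>
    rcases P.gen_tm a with ha | ⟨x, hx, σ, rfl⟩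
    · exact P.hasMGU_var Δ ha htp hne hu
    · rw [P.rTm_gen hx] at ht; cases ht
  | var i =>
    rcases P.gen_tm a with ha | ⟨x, hx, σ, rfl⟩
    · exact P.hasMGU_var Δ ha htp hne hu
    · rw [P.rTm_gen hx] at ht; cases ht
  | app s r ih =>
    rcases P.gen_tm a with ha | ⟨x, hx, σ, rfl⟩
    · exact P.hasMGU_var Δ ha htp hne hu
    rcases P.gen_tm b with hb | ⟨y, hy, τ, rfl⟩
    · rw [eqTm_symm] at hu ⊢
      exact P.hasMGU_var Δ hb htp.symm hne.symm hu
    -- Substitution does not change the head symbol, so unifiability rules out a clash.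
    have hxy : x = y := by
      obtain ⟨Θ, ρ, hρ⟩ := hu
      have hρ := congrArg P.rTm hρ
      rw [← C.tmSub_comp, ← C.tmSub_comp, P.rTm_gen hx, P.rTm_gen hy] at hρ
      exact Sum.inr.inj (Raw.app.inj hρ).1
    subst hxy
    -- Decomposition: symbols are injective in their arguments, so unifying the terms is unifying
    -- the substitutions, whose components are smaller raw expressions.
    have e : eqTm (C.tmSub σ x.2) (C.tmSub τ x.2) = eqHom σ τ := Sieve.ext fun Y w => by
      change C.tmSub w _ = C.tmSub w _ ↔ w ≫ σ = w ≫ τ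
      rw [← C.tmSub_comp, ← C.tmSub_comp]
      refine ⟨fun h => P.rHom_injective fun i _ => ?_, fun h => by rw [h]⟩
      have h := congrArg P.rTm h
      rw [P.rTm_gen hx, P.rTm_gen hx] at h
      exact congrFun (Raw.app.inj h).2 i
    rw [e] at hu ⊢
    rw [P.rTm_gen hx] at ht
    have hr : P.rHom σ = r := (Raw.app.inj ht).2
    exact hasMGU_hom_of_tm Δ hlt σ τ
      (fun i a b ha htp hne hu => ih i a b htp hne hu (by rw [ha, hr]))
      (fun h => hne (by rw [h])) hu

/-- This is the outer induction, on the number of flexible variables, which closes the mutual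
recursion between substitutions and terms. -/
theorem hasMGU_hom {Γ : C.Ctx} (Δ : Tele C Γ) {Z : C.Ctx} (f g : Δ.ext ⟶ Z) (hne : f ≠ g)
    (hu : Unifiable Δ (eqHom f g)) : P.HasMGU Δ (eqHom f g) := by
  obtain ⟨n, hn⟩ : ∃ n, P.len Γ = n := ⟨_, rfl⟩
  induction n using Nat.strong_induction_on generalizing Γ Z with
  | _ n ih =>
    have hlt : ∀ {Γ' : C.Ctx} (Δ' : Tele C Γ') {Z : C.Ctx} (f g : Δ'.ext ⟶ Z),
        P.len Γ' < P.len Γ → f ≠ g → Unifiable Δ' (eqHom f g) → P.HasMGU Δ' (eqHom f g) :=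
      fun {Γ'} Δ' {Z} f g h hne hu => ih (P.len Γ') (hn ▸ h) Δ' f g hne hu rfl
    exact hasMGU_hom_of_tm Δ hlt f g
      (fun _ a b _ htp hne hu => hasMGU_tm_of_hom Δ hlt a b htp hne hu) hne hu

theorem hasMGU_tm {Γ : C.Ctx} (Δ : Tele C Γ) (a b : C.Tm Δ.ext) (htp : C.tp a = C.tp b)
    (hne : a ≠ b) (hu : Unifiable Δ (eqTm a b)) : P.HasMGU Δ (eqTm a b) :=
  hasMGU_tm_of_hom Δ (fun Δ' _ f g _ => P.hasMGU_hom Δ' f g) a b htp hne hu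

/-- Two unifiable types are substitution instances of one type symbol. -/
theorem exists_ty_forms (P : Presentation C) {Q Y : C.Ctx} (A B : C.Ty Q) (w : Y ⟶ Q)
    (h : C.tySub w A = C.tySub w B) :
    ∃ (Z : C.Ctx) (f g : Q ⟶ Z), (f = g → A = B) ∧ ∀ {Y : C.Ctx} (w : Y ⟶ Q),
      C.tySub w A = C.tySub w B ↔ eqHom f g w := by
  obtain ⟨x, hx, σ, rfl⟩ := P.gen_ty A
  obtain ⟨y, hy, τ, rfl⟩ := P.gen_ty B
  have hxy : x = y := by
    have h := congrArg P.rTy h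
    rw [← C.tySub_comp, ← C.tySub_comp, P.rTy_gen hx, P.rTy_gen hy] at h
    exact Sum.inl.inj (Raw.app.inj h).1
  subst hxy
  refine ⟨x.1, σ, τ, fun h => by rw [h], fun w => ?_⟩
  change _ ↔ w ≫ σ = w ≫ τ
  rw [← C.tySub_comp, ← C.tySub_comp]
  refine ⟨fun h => P.rHom_injective fun i _ => ?_, fun h => by rw [h]⟩
  have h := congrArg P.rTy h
  rw [P.rTy_gen hx, P.rTy_gen hx] at h
  exact congrFun (Raw.app.inj h).2 i

/-- A unification problem that is described by a sieve has a most general unifier as soon as it is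
trivial or the sieve has one with fewer flexible variables. -/
theorem exists_mostGeneralUnifier {Γ : C.Ctx} (Δ : Tele C Γ) {X : C.DepPsh Δ.ext} (x₁ x₂ : X.Elt)
    (E : Sieve Δ.ext) (hE : ∀ {Θ : C.Ctx} (ρ : Θ ⟶ Γ), IsUnifier Δ x₁ x₂ ρ ↔ E (Δ.lift ρ))
    (h : x₁ = x₂ ∨ P.HasMGU Δ E) :
    ∃ (Ω : C.Ctx) (ρ : Ω ⟶ Γ), IsMostGeneralUnifier Δ x₁ x₂ ρ ∧
      ((∃ h : Ω = Γ, ρ = eqToHom h) ∨ ∃ m n : ℕ, C.HasLength Ω m ∧ C.HasLength Γ n ∧ m < n) := by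
  rcases h with rfl | ⟨Ω, ρ, h1, h2, h3⟩
  · exact ⟨Γ, 𝟙 Γ, ⟨rfl, fun Θ σ _ => ⟨σ, Category.comp_id σ, fun τ hτ => by simpa using hτ⟩⟩,
      Or.inl ⟨rfl, rfl⟩⟩
  · exact ⟨Ω, ρ, ⟨(hE ρ).2 h1, fun Θ σ hσ => h2 Θ σ ((hE σ).1 hσ)⟩,
      Or.inr ⟨_, _, P.hasLength Ω, P.hasLength Γ, h3⟩⟩

end Presentation

end CwF

/-! ### The unification theorem -/

theorem mainTheorem4 (C : CwF.{u}) (hC : C.IsCellular) {Γ : C.Ctx} (Δ : CwF.Tele C Γ)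
    (X : C.DepPsh Δ.ext) (hX : C.IsSort X) (x₁ x₂ : X.Elt)
    (hu : ∃ (Θ : C.Ctx) (σ : Θ ⟶ Γ), CwF.IsUnifier Δ x₁ x₂ σ) :
    ∃ (Ω : C.Ctx) (ρ : Ω ⟶ Γ), CwF.IsMostGeneralUnifier Δ x₁ x₂ ρ ∧
      ((∃ h : Ω = Γ, ρ = eqToHom h) ∨
        ∃ m n : ℕ, C.HasLength Ω m ∧ C.HasLength Γ n ∧ m < n) := by
  obtain ⟨P⟩ := hC.nonempty_presentation
  -- Equal elements are unified by the identity. For distinct ones the recursion always eliminates a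
  -- flexible variable.
  by_cases hne : x₁ = x₂
  · exact P.exists_mostGeneralUnifier Δ x₁ x₂ ⊤
      (fun ρ => ⟨fun _ => trivial, fun _ => by rw [hne]; rfl⟩) (Or.inl hne)
  obtain ⟨Θ, σ, hσ⟩ := hu
  cases hX with
  | teleTm Ξ =>
    have hE : ∀ {Θ : C.Ctx} (ρ : Θ ⟶ Γ),
        CwF.IsUnifier Δ x₁ x₂ ρ ↔ CwF.eqHom x₁.1 x₂.1 (Δ.lift ρ) := fun ρ => Subtype.ext_iff
    exact P.exists_mostGeneralUnifier Δ x₁ x₂ _ hE (Or.inr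
      (P.hasMGU_hom Δ _ _ (fun h => hne (Subtype.ext h)) ⟨Θ, σ, (hE σ).1 hσ⟩))
  | ty =>
    -- The given unifier forces the two types to have the same symbol, so only their substitutions
    -- remain.
    obtain ⟨Z, f, g, h1, h2⟩ := P.exists_ty_forms x₁ x₂ (Δ.lift σ) hσ
    exact P.exists_mostGeneralUnifier Δ x₁ x₂ _ (fun ρ => h2 (Δ.lift ρ)) (Or.inr
      (P.hasMGU_hom Δ f g (fun h => hne (h1 h)) ⟨Θ, σ, (h2 _).1 hσ⟩))
  | tm A =>
    have hE : ∀ {Θ : C.Ctx} (ρ : Θ ⟶ Γ),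
        CwF.IsUnifier Δ x₁ x₂ ρ ↔ CwF.eqTm x₁.1 x₂.1 (Δ.lift ρ) := fun ρ => Subtype.ext_iff
    exact P.exists_mostGeneralUnifier Δ x₁ x₂ _ hE (Or.inr
      (P.hasMGU_tm Δ _ _ (x₁.2.trans x₂.2.symm) (fun h => hne (Subtype.ext h))
        ⟨Θ, σ, (hE σ).1 hσ⟩))
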